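/- **Model.** Products are the points of $[0,1]$; for $c\in(0,1]$ the feasible assortments are $\mathcal S=\{S\subseteq[0,1]\text{ Borel}:\mathrm{vol}(S)\le c\}$. For a marginal revenue function $w:[0,1]\to[0,1]$ and an integrable preference function $v:[0,1]\to[0,\infty)$, a customer who is offered $S$ buys a product in a Borel set $A\subseteq S$ with probability $\int_A v/(1+\int_S v)$ and buys nothing (outcome $\emptyset$) with probability $1/(1+\int_S v)$. The expected revenue is $r(S,v)=\int_S vw/(1+\int_S v)$. A policy $\pi$ is a sequence of (measurable) maps $\pi_t:(\mathcal S\times([0,1]\cup\{\emptyset\}))^{t-1}\to\mathcal S$; it offers $S_t=\pi_t(S_1,X_1,\dots,S_{t-1},X_{t-1})$ in period $t$, and, given the past, the outcome $X_t$ is distributed as the choice of a customer who is offered $S_t$. Its regret and its worst-case regret over a class $\mathcal V$ of preference functions are $$\Delta_\pi(T,v)=\sum_{t=1}^T\mathbb E_\pi\Big[\sup_{S\in\mathcal S}r(S,v)-r(S_t,v)\Big],\qquad \Delta_\pi(T)=\sup_{v\in\mathcal V}\Delta_\pi(T,v).$$ For reals $\overline v>\underline v>0$ with $\overline v>w(0)/\int_0^1(w(x)-w(0))\,dx$,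 call $\mathcal V$ *regular with bounds $\underline v,\overline v$* if $\underline v\le v(y)\le\overline v$ for all $v\in\mathcal V$, $y\in[0,1]$, and all $v\in\mathcal V$ are differentiable on $(0,1)$ with $\sup_{v\in\mathcal V,\,y\in(0,1)}|v'(y)|<\infty$. **Instance.** Let $c\in(0,\tfrac14]$, $s=0.8c$, $\delta=\tfrac12$, $\sigma=0.3$, and $$w(x)=(1-s)\frac{1-\delta}{1-\delta x}+s,\qquad v_0(x)=\frac{s}{c\,(w(x)-s)},\qquad b(x)=\frac1{\sigma\sqrt{2\pi}}e^{-x^2/(2\sigma^2)}.$$ For an integer $K\ge2$ let $N_K=\lfloor K/c\rfloor$, let $\mathcal A_K$ be the collection of all $I\subseteq\{1,\dots,N_K\}$ with $|I|=K$, and for $I\in\mathcal A_K$ let $$v_I(x)=v_0(x)\Big(1+\sum_{i\in I}\tau_i(x)-\beta\Big),\quad \tau_i(x)=\frac cK\,b\Big(\frac{2Kx}{c}-2i+1\Big),\quad \beta=\frac cK\frac1{\sigma\sqrt{2\pi}}\sum_{n\in\mathbb Z}e^{-(2n-1)^2/(2\sigma^2)} .$$ **Theorem.** For every $\underline v\in(0,0.79)$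 and $\overline v\ge4$, the family $\{v_I:K\ge2,\ I\in\mathcal A_K\}$ is regular with bounds $\underline v,\overline v$. Moreover, there is a constant $\underline C>0$, depending only on $c$, such that, for every such $\underline v,\overline v$, every class $\mathcal V\supseteq\{v_I:K\ge2,\ I\in\mathcal A_K\}$ that is regular with bounds $\underline v,\overline v$ (in particular for this family itself), every $T\in\mathbb N$ and every policy $\pi$, $$\Delta_\pi(T)\ \ge\ \underline C\,T^{2/3}.$$ -/

import Mathlib

open MeasureTheory

namespace ContAssortment

noncomputable section

/-! ### The model: continuous assortment optimization on `[0,1]` -/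

/-- The product space `[0,1]`. It carries Lebesgue measure `volume` (Mathlib's instance on
subtypes of `ℝ`). -/
abbrev Product : Type := Set.Icc (0 : ℝ) 1

/-- The outcomes of one period: the product that is purchased (`Sum.inl x`), or no purchase
(`Sum.inr ()`). -/
abbrev Outcome : Type := Product ⊕ Unit

/-- Feasible assortments: Borel subsets of `[0,1]` of volume at most `c`. -/
abbrev Assortment (c : ℝ) : Type :=
  {S : Set Product // MeasurableSet S ∧ volume S ≤ ENNReal.ofReal c}

/-- The law of the purchase `X^S` of a customer with preference function `v` who is offered `S`:
a set `A ⊆ S` of products has probability `∫_A v / (1 + ∫_S v)` and no purchase has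
probability `1 / (1 + ∫_S v)`. Only the values of `v` on `[0,1]` matter. -/
def purchaseLaw (v : ℝ → ℝ) (S : Set Product) : Measure Outcome :=
  (ENNReal.ofReal (1 + ∫ x in S, v x))⁻¹ •
    (((volume.restrict S).withDensity (fun x => ENNReal.ofReal (v x))).map Sum.inl
      + Measure.dirac (Sum.inr ()))

/-- The expected revenue `r(S, v)` of offering `S`, where `w x` is the marginal revenue of `x`. -/
def revenue (w v : ℝ → ℝ) (S : Set Product) : ℝ :=
  (∫ x in S, v x * w x) / (1 + ∫ x in S, v x)

/-- The optimal expected revenue over all assortments of volume at most `c`. -/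
def optRevenue (c : ℝ) (w v : ℝ → ℝ) : ℝ :=
  ⨆ S : Assortment c, revenue w v S.1

/-- Decision rules: from the sales data of the first `t` periods (offered assortments and
outcomes) to the assortment offered in the next period. -/
abbrev DecisionRule (c : ℝ) : Type :=
  ∀ t : ℕ, (Fin t → Assortment c × Outcome) → Assortment c

/-- The sales data of the first `t` periods when the decision rule `act` is followed and the
outcomes are `h 0, …, h (t - 1)`. -/
def salesData {c : ℝ} (act : DecisionRule c) :
    (t : ℕ) → (Fin t → Outcome) → (Fin t → Assortment c × Outcome)
  | 0, _ => Fin.elim0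
  | t + 1, h =>
    Fin.snoc (α := fun _ => Assortment c × Outcome) (salesData act t (Fin.init h))
      (act t (salesData act t (Fin.init h)), h (Fin.last t))

/-- The assortment that `act` offers in period `t + 1` after the outcomes `h` of the first `t`
periods. -/
def offered {c : ℝ} (act : DecisionRule c) (t : ℕ) (h : Fin t → Outcome) : Assortment c :=
  act t (salesData act t h)

/-- A policy is a decision rule under which the assortment offered depends measurably on the
outcomes observed so far: for all Borel `A ⊆ [0,1]` the volume of `A ∩ S_t` is a measurable
function of these outcomes (this holds if `{(h, x) | x ∈ S_t(h)}` is a measurable set). The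
first `T` components form a policy for `T` periods. -/
structure Policy (c : ℝ) where
  act : DecisionRule c
  measurable_offered : ∀ (t : ℕ) (A : Set Product), MeasurableSet A →
    Measurable fun h : Fin t → Outcome => volume (A ∩ (offered act t h).1)

/-- The joint law of the outcomes of the first `t` periods under policy `π` and preference
function `v`: given the past, the next outcome has the law of `X^S`, with `S` the assortment
that is offered. -/
def outcomeLaw {c : ℝ} (v : ℝ → ℝ) (π : Policy c) : (t : ℕ) → Measure (Fin t → Outcome)
  | 0 => Measure.dirac Fin.elim0
  | t + 1 => (outcomeLaw v π t).bind fun h =>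
      (purchaseLaw v (offered π.act t h).1).map
        fun x => Fin.snoc (α := fun _ => Outcome) h x

/-- The regret `Δ_π(T, v)`. -/
def regret {c : ℝ} (w : ℝ → ℝ) (π : Policy c) (T : ℕ) (v : ℝ → ℝ) : ℝ :=
  ∑ t ∈ Finset.range T,
    ∫ h, (optRevenue c w v - revenue w v (offered π.act t h).1) ∂(outcomeLaw v π t)

/-- The worst-case regret `Δ_π(T)` over a class `V` of preference functions; the supremum is
taken in the extended reals. -/
def worstCaseRegret {c : ℝ} (w : ℝ → ℝ) (V : Set (ℝ → ℝ)) (π : Policy c) (T : ℕ) : EReal :=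
  ⨆ v ∈ V, (regret w π T v : EReal)

/-- The standing assumption on a class `V` of preference functions, with bounds `vlo`, `vhi`. -/
structure RegularClass (w : ℝ → ℝ) (vlo vhi : ℝ) (V : Set (ℝ → ℝ)) : Prop where
  vlo_pos : 0 < vlo
  vlo_lt_vhi : vlo < vhi
  vhi_large : w 0 / (∫ x in (0 : ℝ)..1, (w x - w 0)) < vhi
  bounds : ∀ v ∈ V, ∀ y ∈ Set.Icc (0 : ℝ) 1, vlo ≤ v y ∧ v y ≤ vhi
  differentiable : ∀ v ∈ V, ∀ y ∈ Set.Ioo (0 : ℝ) 1, DifferentiableAt ℝ v y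
  deriv_bounded : ∃ M : ℝ, ∀ v ∈ V, ∀ y ∈ Set.Ioo (0 : ℝ) 1, |deriv v y| ≤ M

/-! ### The hard instance, for a capacity `c` -/

/-- `s = 0.8 c`. -/
def sPar (c : ℝ) : ℝ := 4 / 5 * c

/-- `δ = 1/2`. -/
def deltaPar : ℝ := 1 / 2

/-- `σ = 0.3`. -/
def sigmaPar : ℝ := 3 / 10

/-- The marginal revenue function `w`. -/
def margin (c : ℝ) (x : ℝ) : ℝ :=
  (1 - sPar c) * ((1 - deltaPar) / (1 - deltaPar * x)) + sPar c

/-- The baseline preference function `v₀`. -/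
def baseline (c : ℝ) (x : ℝ) : ℝ :=
  sPar c / (c * (margin c x - sPar c))

/-- The number `N_K = ⌊K/c⌋` of bins; the `i`-th bin is `[c (i-1)/K, c i/K)`, `1 ≤ i ≤ N_K`. -/
def numBins (c : ℝ) (K : ℕ) : ℕ := ⌊(K : ℝ) / c⌋₊

/-- The collection `𝒜_K` of all sets of `K` bins (bins are represented by their indices). -/
def binSets (c : ℝ) (K : ℕ) : Finset (Finset ℕ) :=
  (Finset.Icc 1 (numBins c K)).powersetCard K

/-- The bump function `b`: the density of the normal distribution `N(0, σ²)`. -/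
def bump (x : ℝ) : ℝ :=
  1 / (sigmaPar * √(2 * Real.pi)) * Real.exp (-x ^ 2 / (2 * sigmaPar ^ 2))

/-- The bump `τ_i`, moved to the `i`-th bin and scaled. -/
def binBump (c : ℝ) (K i : ℕ) (x : ℝ) : ℝ :=
  c / K * bump (2 * K * x / c - 2 * i + 1)

/-- The constant `β`. -/
def betaPar (c : ℝ) (K : ℕ) : ℝ :=
  c / K * (1 / (sigmaPar * √(2 * Real.pi))) *
    ∑' n : ℤ, Real.exp (-(2 * (n : ℝ) - 1) ^ 2 / (2 * sigmaPar ^ 2))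

/-- The perturbed preference function `v_I`. -/
def perturbed (c : ℝ) (K : ℕ) (I : Finset ℕ) (x : ℝ) : ℝ :=
  baseline c x * (1 + ∑ i ∈ I, binBump c K i x - betaPar c K)

/-- The family of all `v_I` with `K ≥ 2` and `I ∈ 𝒜_K`. -/
def hardFamily (c : ℝ) : Set (ℝ → ℝ) :=
  {v | ∃ K : ℕ, 2 ≤ K ∧ ∃ I ∈ binSets c K, v = perturbed c K I}

end

end ContAssortment

/-!
The baseline `v₀` makes `v₀ (w - s)` constant, so that for `v₀` every assortment of volume `c` is
optimal with revenue `s`. The bumps of `v_I` raise the revenue by an amount of order `1 / K`, to be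
collected only by offering the `K` bins of `I`. A policy therefore has to find these bins, but each
bump has height and width of order `1 / K`, so one period reveals information of order `K ^ (-3)`
about it. With `K` a large multiple of `T ^ (1 / 3)` the bins cannot be found within `T` periods,
every period costs a constant multiple of `1 / K`, and the regret is of order `T / K`, that is,
`T ^ (2 / 3)`.

The loss of an assortment in terms of its overlap with the bins of `I` is
`optRevenue_sub_revenue_ge`. Only crude bounds are needed: the bumps are bounded by their peak on
their own bins, and by a small multiple of `c / K` elsewhere (`sum_binBump_tail_le`).

The lower bound uses a product prior: the first `4 K` bins form `K` groups of four, and `I` takes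
one bin of each group, chosen independently and uniformly (`selectedBins`). Resampling the choice
in one group changes the law of one purchase by a chi-squared divergence of at most `K ^ (-3)`
(`divergence_perturbed_le`, `sq_lintegral_purchaseLaw_le`). Divergence bounds of this kind multiply
along an adaptive policy (`sq_lintegral_outcomeLaw_le`), and they bound differences of means
(`integral_le_add_of_sq_lintegral_le`). So the policy offers the chosen bin of a group hardly more
than the other three, and since at most the volume `c` of `K` bins is offered, on average hardly
more than a quarter of the volume of the chosen bins is covered (`sum_selected_le`). This falls
short of what the optimal revenue requires (`exists_regret_ge`).
-/

namespace ContAssortment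

variable {c : ℝ} {K : ℕ}

/-! ### Sums and integrals of the Gaussian bumps -/

/-- The maximum `b(0)` of the bump function. -/
noncomputable def peak : ℝ := 1 / (sigmaPar * √(2 * Real.pi))

lemma peak_pos : 0 < peak := by
  unfold peak sigmaPar
  positivity

lemma peak_le : peak ≤ 4 / 3 := by
  have h : (5 / 2 : ℝ) ≤ √(2 * Real.pi) := by
    apply Real.le_sqrt_of_sq_le
    linarith [Real.pi_gt_d2]
  unfold peak sigmaPar
  rw [div_le_div_iff₀ (by positivity) (by norm_num)]
  linarith

lemma bump_eq (u : ℝ) : bump u = peak * Real.exp (-(50 / 9) * u ^ 2) := by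
  unfold bump peak sigmaPar
  congr 2
  ring

lemma bump_pos (u : ℝ) : 0 < bump u := by
  rw [bump_eq]
  exact mul_pos peak_pos (Real.exp_pos _)

lemma bump_le (u : ℝ) : bump u ≤ 4 / 3 := by
  rw [bump_eq]
  have h : Real.exp (-(50 / 9) * u ^ 2) ≤ 1 := Real.exp_le_one_iff.2 (by nlinarith [sq_nonneg u])
  nlinarith [peak_le, peak_pos, Real.exp_pos (-(50 / 9) * u ^ 2)]

lemma continuous_bump : Continuous bump := by
  have : bump = fun u => peak * Real.exp (-(50 / 9) * u ^ 2) := funext bump_eq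
  rw [this]
  fun_prop

lemma exp_neg_rate_le : Real.exp (-(50 / 9)) ≤ 1 / 148 := by
  have h1 : (2.718 : ℝ) < Real.exp 1 := lt_trans (by norm_num) Real.exp_one_gt_d9
  have h2 : Real.exp 5 = Real.exp 1 ^ 5 := by
    rw [← Real.exp_nat_mul]
    norm_num
  have h3 : (148 : ℝ) ≤ Real.exp 5 := by
    rw [h2]
    calc (148 : ℝ) ≤ 2.718 ^ 5 := by norm_num
      _ ≤ _ := pow_le_pow_left₀ (by norm_num) h1.le 5
  calc Real.exp (-(50 / 9)) ≤ Real.exp (-5) := Real.exp_le_exp.2 (by norm_num)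
    _ = 1 / Real.exp 5 := by rw [Real.exp_neg, one_div]
    _ ≤ 1 / 148 := one_div_le_one_div_of_le (by norm_num) h3

/-- A two-sided geometric series without its central term. -/
lemma sum_pow_natAbs_le {r : ℝ} (hr0 : 0 ≤ r) (hr1 : r < 1) (s : Finset ℤ) (hs : (0 : ℤ) ∉ s) :
    ∑ n ∈ s, r ^ n.natAbs ≤ 2 * r / (1 - r) := by
  have h1 : HasSum (fun n : ℕ => r ^ (n : ℤ).natAbs) (1 - r)⁻¹ := by
    simpa using hasSum_geometric_of_lt_one hr0 hr1
  have h2 : HasSum (fun n : ℕ => r ^ (-((n : ℤ) + 1)).natAbs) (r * (1 - r)⁻¹) := by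
    have h : (fun n : ℕ => r ^ (-((n : ℤ) + 1)).natAbs) = fun n : ℕ => r * r ^ n := by
      funext n
      rw [show (-((n : ℤ) + 1)).natAbs = n + 1 by omega, pow_succ']
    rw [h]
    exact (hasSum_geometric_of_lt_one hr0 hr1).mul_left r
  have h3 := HasSum.of_nat_of_neg_add_one (f := fun n : ℤ => r ^ n.natAbs) h1 h2
  have h4 := sum_le_hasSum (insert 0 s) (fun i _ => by positivity) h3
  rw [Finset.sum_insert hs] at h4
  have h5 : 2 * r / (1 - r) = (1 - r)⁻¹ + r * (1 - r)⁻¹ - 1 := by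
    have : 1 - r ≠ 0 := by linarith
    field_simp
    ring
  rw [h5]
  simp at h4
  linarith

/-- If `y` lies within distance `1` of `2 i`, then the Gaussians centred at the other even
integers have a small sum at `y`. -/
lemma sum_exp_tail_le {a : ℝ} (ha : 0 < a) {y : ℝ} {i : ℤ} (hi : |y - 2 * i| ≤ 1)
    (s : Finset ℕ) (hs : ∀ j ∈ s, (j : ℤ) ≠ i) :
    ∑ j ∈ s, Real.exp (-a * (y - 2 * j) ^ 2) ≤ 2 * Real.exp (-a) / (1 - Real.exp (-a)) := by
  have hinj : Set.InjOn (fun j : ℕ => (j : ℤ) - i) s := fun a _ b _ h => by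
    simp only at h
    omega
  refine le_trans ?_ (sum_pow_natAbs_le (Real.exp_pos _).le
    (Real.exp_lt_one_iff.2 (by linarith)) (s.image fun j : ℕ => (j : ℤ) - i) ?_)
  · rw [Finset.sum_image hinj]
    refine Finset.sum_le_sum fun j hj => ?_
    rw [← Real.exp_nat_mul]
    refine Real.exp_le_exp.2 ?_
    have hne := hs j hj
    have hnat : ((((j : ℤ) - i).natAbs : ℕ) : ℝ) = |(j : ℝ) - i| := by
      rw [Nat.cast_natAbs]
      push_cast
      rfl
    have hone : (1 : ℝ) ≤ |(j : ℝ) - i| := by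
      have : (1 : ℤ) ≤ |(j : ℤ) - i| := Int.one_le_abs (sub_ne_zero.2 hne)
      exact_mod_cast this
    rw [hnat]
    have hsq : |(j : ℝ) - i| ≤ (y - 2 * j) ^ 2 := by
      have h1 : 2 * |(j : ℝ) - i| - 1 ≤ |y - 2 * j| := by
        have : |2 * ((j : ℝ) - i)| ≤ |y - 2 * j| + |y - 2 * i| := by
          have := abs_sub (y - 2 * i) (y - 2 * j)
          rw [show y - 2 * (i : ℝ) - (y - 2 * j) = 2 * (j - i) by ring] at this
          linarith
        rw [abs_mul, abs_two] at this
        linarith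
      rw [← sq_abs (y - 2 * j)]
      nlinarith
    nlinarith
  · simp only [Finset.mem_image, not_exists, not_and]
    intro j hj h
    exact hs j hj (by omega)

lemma exists_nearest_even (y : ℝ) : ∃ i : ℤ, |y - 2 * i| ≤ 1 := by
  refine ⟨round (y / 2), ?_⟩
  have := abs_sub_round (y / 2)
  rw [show y - 2 * (round (y / 2) : ℝ) = 2 * (y / 2 - round (y / 2)) by ring, abs_mul, abs_two]
  linarith

lemma sum_exp_le {a : ℝ} (ha : 0 < a) (y : ℝ) (s : Finset ℕ) :
    ∑ j ∈ s, Real.exp (-a * (y - 2 * j) ^ 2) ≤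
      1 + 2 * Real.exp (-a) / (1 - Real.exp (-a)) := by
  obtain ⟨i, hi⟩ := exists_nearest_even y
  rw [← Finset.sum_filter_add_sum_filter_not s (fun j : ℕ => (j : ℤ) = i)]
  refine add_le_add ?_ (sum_exp_tail_le ha hi _ fun j hj => (Finset.mem_filter.1 hj).2)
  have hcard : (s.filter fun j : ℕ => (j : ℤ) = i).card ≤ 1 :=
    Finset.card_le_one.2 fun a ha b hb => by
      have h1 := (Finset.mem_filter.1 ha).2
      have h2 := (Finset.mem_filter.1 hb).2
      omega
  calc _ ≤ ∑ j ∈ s.filter (fun j : ℕ => (j : ℤ) = i), (1 : ℝ) :=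
        Finset.sum_le_sum fun j _ => Real.exp_le_one_iff.2 (by nlinarith [sq_nonneg (y - 2 * j)])
    _ ≤ 1 := by
      rw [Finset.sum_const, nsmul_eq_mul, mul_one]
      exact_mod_cast hcard

lemma tail_const_le :
    4 / 3 * (2 * Real.exp (-(50 / 9)) / (1 - Real.exp (-(50 / 9)))) ≤ 1 / 50 := by
  have h := exp_neg_rate_le
  have : 2 * Real.exp (-(50 / 9)) / (1 - Real.exp (-(50 / 9))) ≤ 2 / 147 := by
    rw [div_le_div_iff₀ (by linarith) (by norm_num)]
    linarith
  linarith

lemma binBump_eq (i : ℕ) (x : ℝ) :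
    binBump c K i x =
      c / K * (peak * Real.exp (-(50 / 9) * (2 * K * x / c + 1 - 2 * i) ^ 2)) := by
  rw [binBump, bump_eq]
  congr 4
  ring

lemma binBump_nonneg (hc : 0 < c) (i : ℕ) (x : ℝ) : 0 ≤ binBump c K i x :=
  mul_nonneg (by positivity) (bump_pos _).le

lemma binBump_le (hc : 0 < c) (i : ℕ) (x : ℝ) : binBump c K i x ≤ c / K * (4 / 3) :=
  mul_le_mul_of_nonneg_left (bump_le _) (by positivity)

lemma continuous_binBump (i : ℕ) : Continuous (binBump c K i) := by
  unfold binBump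
  have := continuous_bump
  fun_prop

/-- At a point of the `i`-th bin, the bumps of the other bins are negligible. -/
lemma sum_binBump_tail_le (hc : 0 < c) {x : ℝ} {i : ℤ} (hi : |2 * K * x / c + 1 - 2 * i| ≤ 1)
    (s : Finset ℕ) (hs : ∀ j ∈ s, (j : ℤ) ≠ i) :
    ∑ j ∈ s, binBump c K j x ≤ c / K * (1 / 50) := by
  simp_rw [binBump_eq, ← Finset.mul_sum]
  refine mul_le_mul_of_nonneg_left ?_ (by positivity)
  have h := sum_exp_tail_le (a := 50 / 9) (by norm_num) hi s hs
  refine le_trans (mul_le_mul peak_le h (Finset.sum_nonneg fun _ _ => (Real.exp_pos _).le)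
    (by norm_num)) tail_const_le

lemma sum_binBump_nonneg (hc : 0 < c) (s : Finset ℕ) (x : ℝ) :
    0 ≤ ∑ j ∈ s, binBump c K j x :=
  Finset.sum_nonneg fun j _ => binBump_nonneg hc j x

lemma sum_binBump_le (hc : 0 < c) (s : Finset ℕ) (x : ℝ) :
    ∑ j ∈ s, binBump c K j x ≤ c / K * (34 / 25) := by
  obtain ⟨i, hi⟩ := exists_nearest_even (2 * K * x / c + 1)
  rw [← Finset.sum_filter_add_sum_filter_not s (fun j : ℕ => (j : ℤ) = i)]
  have h1 := sum_binBump_tail_le hc hi (s.filter fun j : ℕ => ¬ (j : ℤ) = i)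
    fun j hj => (Finset.mem_filter.1 hj).2
  have hcard : (s.filter fun j : ℕ => (j : ℤ) = i).card ≤ 1 :=
    Finset.card_le_one.2 fun a ha b hb => by
      have h1 := (Finset.mem_filter.1 ha).2
      have h2 := (Finset.mem_filter.1 hb).2
      omega
  have h2 : ∑ j ∈ s.filter (fun j : ℕ => (j : ℤ) = i), binBump c K j x ≤ c / K * (4 / 3) := by
    refine (Finset.sum_le_card_nsmul _ _ _ fun j _ => binBump_le hc j x).trans ?_
    rw [nsmul_eq_mul]
    have : ((s.filter fun j : ℕ => (j : ℤ) = i).card : ℝ) ≤ 1 := by exact_mod_cast hcard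
    have h0 : 0 ≤ c / K * (4 / 3) := by positivity
    nlinarith
  have h0 : 0 ≤ c / K := by positivity
  linarith

lemma betaPar_nonneg (hc : 0 < c) : 0 ≤ betaPar c K := by
  unfold betaPar
  have : 0 ≤ ∑' n : ℤ, Real.exp (-(2 * (n : ℝ) - 1) ^ 2 / (2 * sigmaPar ^ 2)) :=
    tsum_nonneg fun _ => (Real.exp_pos _).le
  have h2 := peak_pos
  unfold peak at h2
  exact mul_nonneg (mul_nonneg (by positivity) h2.le) this

lemma betaPar_le (hc : 0 < c) : betaPar c K ≤ c / K * (1 / 50) := by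
  have hsum : ∑' n : ℤ, Real.exp (-(2 * (n : ℝ) - 1) ^ 2 / (2 * sigmaPar ^ 2)) ≤
      2 * Real.exp (-(50 / 9)) / (1 - Real.exp (-(50 / 9))) := by
    have hlt : Real.exp (-(50 / 9)) < 1 := Real.exp_lt_one_iff.2 (by norm_num)
    refine tsum_le_of_sum_le' (div_nonneg (by positivity) (by linarith)) fun s => ?_
    have hinj : Set.InjOn (fun n : ℤ => 2 * n - 1) s := fun a _ b _ h => by
      simp only at h
      omega
    refine le_trans ?_ (sum_pow_natAbs_le (Real.exp_pos _).le hlt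
      (s.image fun n : ℤ => 2 * n - 1) ?_)
    · rw [Finset.sum_image hinj]
      refine Finset.sum_le_sum fun n _ => ?_
      rw [← Real.exp_nat_mul]
      refine Real.exp_le_exp.2 ?_
      have hnat : (((2 * n - 1).natAbs : ℕ) : ℝ) = |2 * (n : ℝ) - 1| := by
        rw [Nat.cast_natAbs]
        push_cast
        rfl
      have hone : (1 : ℝ) ≤ |2 * (n : ℝ) - 1| := by
        have : (1 : ℤ) ≤ |2 * n - 1| := Int.one_le_abs (by omega)
        exact_mod_cast this
      rw [hnat, sigmaPar, ← sq_abs (2 * (n : ℝ) - 1)]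
      ring_nf at *
      nlinarith
    · simp only [Finset.mem_image, not_exists, not_and]
      intro n _ h
      omega
  unfold betaPar
  rw [mul_assoc]
  refine mul_le_mul_of_nonneg_left ?_ (by positivity)
  exact le_trans (mul_le_mul peak_le hsum (tsum_nonneg fun _ => (Real.exp_pos _).le)
    (by norm_num)) tail_const_le

lemma integrable_bump : Integrable bump := by
  have : bump = fun u => peak * Real.exp (-(50 / 9) * u ^ 2) := funext bump_eq
  rw [this]
  exact (integrable_exp_neg_mul_sq (by norm_num)).const_mul _

lemma integral_bump : ∫ u, bump u = 1 := by
  simp_rw [bump_eq]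
  rw [integral_const_mul, integral_gaussian, peak, sigmaPar]
  rw [show Real.pi / (50 / 9) = (3 / 10) ^ 2 * (2 * Real.pi) by ring,
    Real.sqrt_mul (x := (3 / 10) ^ 2) (by norm_num), Real.sqrt_sq (x := 3 / 10) (by norm_num)]
  have : √(2 * Real.pi) ≠ 0 := by positivity
  field_simp

lemma bump_neg (u : ℝ) : bump (-u) = bump u := by
  simp [bump]

lemma integral_bump_Ioi_le : ∫ u in Set.Ioi (1 : ℝ), bump u ≤ 1 / 200 := by
  have hle : ∀ u ∈ Set.Ioi (1 : ℝ), bump u ≤ 4 / 3 * Real.exp (-(50 / 9) * u) := by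
    intro u hu
    rw [bump_eq]
    have hu' : (1 : ℝ) < u := hu
    exact mul_le_mul peak_le (Real.exp_le_exp.2 (by nlinarith)) (Real.exp_pos _).le (by norm_num)
  have hint : IntegrableOn (fun u => 4 / 3 * Real.exp (-(50 / 9) * u)) (Set.Ioi (1 : ℝ)) :=
    (integrableOn_exp_mul_Ioi (by norm_num) 1).const_mul _
  refine (setIntegral_mono_on integrable_bump.integrableOn hint measurableSet_Ioi hle).trans ?_
  rw [integral_const_mul, integral_exp_mul_Ioi (by norm_num)]
  have := exp_neg_rate_le
  norm_num at *
  linarith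

lemma integral_bump_bin : 99 / 100 ≤ ∫ u in (-1 : ℝ)..1, bump u := by
  have h1 : ∫ u in Set.Iic (-1 : ℝ), bump u = ∫ u in Set.Ioi (1 : ℝ), bump u := by
    rw [← integral_comp_neg_Ioi]
    simp [bump_neg]
  have h2 := integral_bump_Ioi_le
  have h3 := intervalIntegral.integral_Iic_add_Ioi (f := bump) (b := (1 : ℝ)) (μ := volume)
    integrable_bump.integrableOn integrable_bump.integrableOn
  have h4 := intervalIntegral.integral_Iic_sub_Iic (f := bump) (a := (-1 : ℝ)) (b := 1)
    (μ := volume) integrable_bump.integrableOn integrable_bump.integrableOn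
  rw [integral_bump] at h3
  linarith

/-! ### Bounds for the preference functions and regularity of the hard family -/

/-- Valid at `x = 2` too, where both sides are zero. -/
lemma baseline_eq (hc0 : 0 < c) (x : ℝ) :
    baseline c x = 4 / 5 * (2 - x) / (1 - sPar c) := by
  unfold baseline margin deltaPar
  rw [add_sub_cancel_right, show sPar c = c * (4 / 5) by rw [sPar]; ring,
    mul_div_mul_left _ _ hc0.ne', mul_div_assoc', div_div_eq_mul_div]
  rw [show 4 / 5 * (1 - 1 / 2 * x) = 4 / 5 * (2 - x) * (1 - 1 / 2) by ring,
    mul_div_mul_right _ _ (by norm_num)]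

lemma sPar_pos (hc0 : 0 < c) : 0 < sPar c := by
  unfold sPar
  positivity

lemma sPar_le (hc1 : c ≤ 1 / 4) : sPar c ≤ 1 / 5 := by
  unfold sPar
  linarith

lemma baseline_mem (hc0 : 0 < c) (hc1 : c ≤ 1 / 4) {x : ℝ} (hx : x ∈ Set.Icc (0 : ℝ) 1) :
    baseline c x ∈ Set.Icc (4 / 5 : ℝ) 2 := by
  have h1 := sPar_pos hc0
  have h2 := sPar_le hc1
  rw [baseline_eq hc0]
  refine ⟨?_, ?_⟩
  · rw [le_div_iff₀ (by linarith)]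
    linarith [hx.2]
  · rw [div_le_iff₀ (by linarith)]
    linarith [hx.1]

lemma continuous_perturbed (hc0 : 0 < c) (I : Finset ℕ) : Continuous (perturbed c K I) := by
  have h : perturbed c K I = fun x => 4 / 5 * (2 - x) / (1 - sPar c) *
      (1 + ∑ i ∈ I, binBump c K i x - betaPar c K) := by
    funext x
    rw [perturbed, baseline_eq hc0]
  have hb := fun i => continuous_binBump (c := c) (K := K) i
  rw [h]
  fun_prop

lemma margin_eq (x : ℝ) : margin c x = (1 - sPar c) / (2 - x) + sPar c := by
  unfold margin deltaPar
  rw [show 1 - 1 / 2 * x = (2 - x) * (1 / 2) by ring, show (1 : ℝ) - 1 / 2 = 1 * (1 / 2) by ring,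
    mul_div_mul_right _ _ (by norm_num), mul_div_assoc', mul_one]

lemma margin_mem (hc0 : 0 < c) (hc1 : c ≤ 1 / 4) {x : ℝ} (hx : x ∈ Set.Icc (0 : ℝ) 1) :
    margin c x ∈ Set.Icc (0 : ℝ) 1 := by
  have h1 := sPar_pos hc0
  have h2 := sPar_le hc1
  rw [margin_eq]
  have h3 : 0 < 2 - x := by linarith [hx.2]
  refine ⟨add_nonneg (div_nonneg (by linarith) h3.le) h1.le, ?_⟩
  have : (1 - sPar c) / (2 - x) ≤ 1 - sPar c := by
    rw [div_le_iff₀ h3]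
    nlinarith [hx.2]
  linarith

/-- The baseline is chosen to make `v₀ (w - s)` constant. -/
lemma perturbed_mul_margin (hc0 : 0 < c) (hc1 : c ≤ 1 / 4) (I : Finset ℕ) {x : ℝ}
    (hx : x ∈ Set.Icc (0 : ℝ) 1) :
    perturbed c K I x * margin c x = sPar c * perturbed c K I x +
      4 / 5 * (1 + ∑ i ∈ I, binBump c K i x - betaPar c K) := by
  have h2 := sPar_le hc1
  rw [margin_eq, perturbed, baseline_eq hc0]
  have h3 : 2 - x ≠ 0 := by linarith [hx.2]
  have h4 : 1 - sPar c ≠ 0 := by linarith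
  field_simp
  ring

lemma perturbed_bounds (hc0 : 0 < c) (hc1 : c ≤ 1 / 4) (hK : 2 ≤ K) (I : Finset ℕ) {x : ℝ}
    (hx : x ∈ Set.Icc (0 : ℝ) 1) :
    79 / 100 ≤ perturbed c K I x ∧ perturbed c K I x ≤ 2 * (1 + c / K * (34 / 25)) := by
  obtain ⟨h1, h2⟩ := baseline_mem hc0 hc1 hx
  have h3 := sum_binBump_nonneg (K := K) hc0 I x
  have h4 := sum_binBump_le (K := K) hc0 I x
  have h5 := betaPar_nonneg (K := K) hc0
  have h6 := betaPar_le (K := K) hc0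
  have hK' : (2 : ℝ) ≤ K := by exact_mod_cast hK
  have h7 : c / K ≤ 1 / 8 := by
    rw [div_le_iff₀ (by linarith)]
    linarith
  unfold perturbed
  constructor <;> nlinarith

lemma capacity_div_le (hc1 : c ≤ 1 / 4) (hK : 2 ≤ K) : c / K ≤ 1 / 8 := by
  have hK' : (2 : ℝ) ≤ K := by exact_mod_cast hK
  rw [div_le_iff₀ (by linarith)]
  linarith

lemma hasDerivAt_bump (u : ℝ) :
    HasDerivAt bump (peak * (Real.exp (-(50 / 9) * u ^ 2) * (-(100 / 9) * u))) u := by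
  have h : bump = fun u => peak * Real.exp (-(50 / 9) * u ^ 2) := funext bump_eq
  rw [h]
  have h1 : HasDerivAt (fun u : ℝ => -(50 / 9) * u ^ 2) (-(100 / 9) * u) u := by
    refine ((hasDerivAt_pow 2 u).const_mul (-(50 / 9))).congr_deriv ?_
    norm_num
    ring
  exact (h1.exp).const_mul peak

/-- A part of the Gaussian decay absorbs the linear factor of the derivative. -/
lemma abs_deriv_bump_le (u : ℝ) :
    |peak * (Real.exp (-(50 / 9) * u ^ 2) * (-(100 / 9) * u))| ≤
      400 / 27 * Real.exp (-(41 / 9) * u ^ 2) := by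
  have h1 : |u| ≤ Real.exp (u ^ 2) := by
    have := Real.add_one_le_exp (u ^ 2)
    rw [← sq_abs] at this ⊢
    nlinarith [sq_nonneg (|u| - 1)]
  have h2 : Real.exp (-(50 / 9) * u ^ 2) * Real.exp (u ^ 2) = Real.exp (-(41 / 9) * u ^ 2) := by
    rw [← Real.exp_add]
    ring_nf
  rw [abs_mul, abs_mul, abs_mul, abs_of_pos peak_pos, Real.abs_exp, ← h2]
  rw [show |(-(100 / 9) : ℝ)| = 100 / 9 by norm_num [abs_of_pos]]
  have h3 := mul_le_mul_of_nonneg_left h1 (Real.exp_pos (-(50 / 9) * u ^ 2)).le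
  calc _ = peak * (100 / 9 * (Real.exp (-(50 / 9) * u ^ 2) * |u|)) := by ring
    _ ≤ 4 / 3 * (100 / 9 * (Real.exp (-(50 / 9) * u ^ 2) * Real.exp (u ^ 2))) :=
      mul_le_mul peak_le (by linarith) (by positivity) (by norm_num)
    _ = _ := by ring

/-- The height `c / K` of a bump compensates the scaling factor `2 K / c`, so the slopes do not
grow with `K`. -/
lemma hasDerivAt_binBump (hc0 : 0 < c) (hK : 0 < K) (i : ℕ) (x : ℝ) :
    ∃ d, HasDerivAt (binBump c K i) d x ∧
      |d| ≤ 800 / 27 * Real.exp (-(41 / 9) * (2 * K * x / c + 1 - 2 * i) ^ 2) := by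
  have hlin : HasDerivAt (fun x : ℝ => 2 * K * x / c - 2 * i + 1) (2 * K / c) x := by
    have := (((hasDerivAt_id x).const_mul (2 * K : ℝ)).div_const c).sub_const (2 * i : ℝ)
    simpa using this.add_const (1 : ℝ)
  have h := ((hasDerivAt_bump (2 * K * x / c - 2 * i + 1)).comp x hlin).const_mul (c / K)
  refine ⟨_, h, ?_⟩
  have hK' : (K : ℝ) ≠ 0 := by positivity
  have hb := abs_deriv_bump_le (2 * K * x / c - 2 * i + 1)
  rw [show ∀ z : ℝ, c / K * (z * (2 * K / c)) = 2 * z by intro z; field_simp, abs_mul, abs_two]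
  rw [show 2 * (K : ℝ) * x / c + 1 - 2 * i = 2 * K * x / c - 2 * i + 1 by ring]
  linarith

lemma hasDerivAt_perturbed (hc0 : 0 < c) (hc1 : c ≤ 1 / 4) (hK : 2 ≤ K) (I : Finset ℕ) {x : ℝ}
    (hx : x ∈ Set.Icc (0 : ℝ) 1) :
    ∃ d, HasDerivAt (perturbed c K I) d x ∧ |d| ≤ 200 := by
  choose d hd hdle using fun i => hasDerivAt_binBump (K := K) hc0 (by omega) i x
  have h1 := sPar_pos hc0
  have h2 := sPar_le hc1
  have hbase : HasDerivAt (baseline c) (-(4 / 5) / (1 - sPar c)) x := by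
    have hfun : baseline c = fun x => 4 / 5 * (2 - x) / (1 - sPar c) :=
      funext (baseline_eq hc0)
    rw [hfun]
    refine (((((hasDerivAt_id x).const_sub (2 : ℝ)).const_mul (4 / 5 : ℝ)).div_const
      (1 - sPar c))).congr_deriv ?_
    ring
  have hsum : HasDerivAt (fun x => 1 + ∑ i ∈ I, binBump c K i x - betaPar c K)
      (∑ i ∈ I, d i) x :=
    ((HasDerivAt.fun_sum fun i _ => hd i).const_add 1).sub_const _
  refine ⟨_, hbase.mul hsum, ?_⟩
  have h3 : |∑ i ∈ I, d i| ≤ 89 := by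
    have he : Real.exp (-(41 / 9)) ≤ 1 / 2 := by
      have := Real.add_one_le_exp (41 / 9 : ℝ)
      rw [Real.exp_neg, ← one_div]
      exact one_div_le_one_div_of_le (by norm_num) (by linarith)
    have he2 : 2 * Real.exp (-(41 / 9)) / (1 - Real.exp (-(41 / 9))) ≤ 2 := by
      rw [div_le_iff₀ (by linarith)]
      linarith
    have hs := sum_exp_le (a := 41 / 9) (by norm_num) (2 * K * x / c + 1) I
    calc |∑ i ∈ I, d i| ≤ ∑ i ∈ I, |d i| := Finset.abs_sum_le_sum_abs _ _
      _ ≤ ∑ i ∈ I, 800 / 27 * Real.exp (-(41 / 9) * (2 * K * x / c + 1 - 2 * i) ^ 2) :=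
        Finset.sum_le_sum fun i _ => hdle i
      _ ≤ 800 / 27 * 3 := by
        rw [← Finset.mul_sum]
        exact mul_le_mul_of_nonneg_left (by linarith) (by norm_num)
      _ ≤ 89 := by norm_num
  obtain ⟨hb1, hb2⟩ := baseline_mem hc0 hc1 hx
  have h4 : |-(4 / 5) / (1 - sPar c)| ≤ 1 := by
    rw [abs_div, abs_of_pos (show 0 < 1 - sPar c by linarith), div_le_one (by linarith)]
    norm_num [abs_of_pos]
    linarith
  have h5 : |1 + ∑ i ∈ I, binBump c K i x - betaPar c K| ≤ 2 := by
    have := sum_binBump_nonneg (K := K) hc0 I x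
    have := sum_binBump_le (K := K) hc0 I x
    have := betaPar_nonneg (K := K) hc0
    have := betaPar_le (K := K) hc0
    have := capacity_div_le hc1 hK
    rw [abs_le]
    constructor <;> linarith
  calc _ ≤ |-(4 / 5) / (1 - sPar c)| * |1 + ∑ i ∈ I, binBump c K i x - betaPar c K| +
        |baseline c x| * |∑ i ∈ I, d i| := by
          rw [← abs_mul, ← abs_mul]
          exact abs_add_le _ _
    _ ≤ 1 * 2 + 2 * 89 := by
      rw [abs_of_pos (show 0 < baseline c x by linarith)]
      gcongr
    _ ≤ 200 := by norm_num

lemma integral_margin_sub :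
    ∫ x in (0 : ℝ)..1, (margin c x - margin c 0) = (1 - sPar c) * (Real.log 2 - 1 / 2) := by
  have h : ∀ x, margin c x - margin c 0 = (1 - sPar c) * ((2 - x)⁻¹ - 1 / 2) := by
    intro x
    rw [margin_eq, margin_eq]
    ring
  simp_rw [h]
  rw [intervalIntegral.integral_const_mul, intervalIntegral.integral_sub,
    intervalIntegral.integral_comp_sub_left (fun x => x⁻¹) 2]
  · rw [integral_inv]
    · norm_num
    · norm_num [Set.mem_uIcc]
  · refine ContinuousOn.intervalIntegrable ?_
    refine ContinuousOn.inv₀ (by fun_prop) fun x hx => ?_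
    rw [Set.uIcc_of_le (by norm_num)] at hx
    linarith [hx.2]
  · exact intervalIntegrable_const

theorem regularClass_hardFamily (hc0 : 0 < c) (hc1 : c ≤ 1 / 4) {vlo vhi : ℝ} (h0 : 0 < vlo)
    (hlo : vlo < 79 / 100) (hhi : 4 ≤ vhi) :
    RegularClass (margin c) vlo vhi (hardFamily c) where
  vlo_pos := h0
  vlo_lt_vhi := by linarith
  vhi_large := by
    have h1 := sPar_pos hc0
    have h2 := sPar_le hc1
    -- the quotient is largest at `c = 1 / 4`, where it is about `3.88`
    have h3 := Real.log_two_gt_d9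
    rw [integral_margin_sub, margin_eq, div_lt_iff₀ (by nlinarith)]
    have h4 : 4 * ((1 - sPar c) * (0.693147 - 1 / 2)) ≤
        vhi * ((1 - sPar c) * (Real.log 2 - 1 / 2)) := by
      have h5 : (1 - sPar c) * (0.693147 - 1 / 2) ≤ (1 - sPar c) * (Real.log 2 - 1 / 2) :=
        mul_le_mul_of_nonneg_left (by linarith) (by linarith)
      exact mul_le_mul hhi h5 (by nlinarith) (by linarith)
    linarith
  bounds := by
    rintro v ⟨K, hK, I, -, rfl⟩ y hy
    obtain ⟨h1, h2⟩ := perturbed_bounds hc0 hc1 hK I hy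
    have := capacity_div_le hc1 hK
    constructor <;> linarith
  differentiable := by
    rintro v ⟨K, hK, I, -, rfl⟩ y hy
    obtain ⟨d, hd, -⟩ := hasDerivAt_perturbed hc0 hc1 hK I (Set.Ioo_subset_Icc_self hy)
    exact hd.differentiableAt
  deriv_bounded := by
    refine ⟨200, ?_⟩
    rintro v ⟨K, hK, I, -, rfl⟩ y hy
    obtain ⟨d, hd, hle⟩ := hasDerivAt_perturbed hc0 hc1 hK I (Set.Ioo_subset_Icc_self hy)
    rwa [hd.deriv]

/-! ### Change of measure along a policy -/

open ProbabilityTheory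

variable {v v' : ℝ → ℝ}

lemma integrableOn_pref {f : Product → ℝ} (hf : Continuous f) (S : Set Product) :
    IntegrableOn f S :=
  (hf.integrable_of_hasCompactSupport (HasCompactSupport.of_compactSpace f)).integrableOn

lemma continuous_pref (hv : Continuous v) : Continuous fun x : Product => v x :=
  hv.comp continuous_subtype_val

lemma lintegral_pref (hv : Continuous v) (h0 : ∀ x ∈ Set.Icc (0 : ℝ) 1, 0 ≤ v x)
    (S : Set Product) :
    ENNReal.ofReal (1 + ∫ x in S, v x) = 1 + ∫⁻ x in S, ENNReal.ofReal (v x) := by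
  have hnn : ∀ x : Product, 0 ≤ v x := fun x => h0 x x.2
  rw [ENNReal.ofReal_add zero_le_one (integral_nonneg hnn), ENNReal.ofReal_one,
    ofReal_integral_eq_lintegral_ofReal (integrableOn_pref (continuous_pref hv) S)
      (Filter.Eventually.of_forall hnn)]

/-- The purchase law before normalization. -/
noncomputable def choiceMeasure (v : ℝ → ℝ) (S : Set Product) : Measure Outcome :=
  ((volume.restrict S).withDensity (fun x => ENNReal.ofReal (v x))).map Sum.inl
    + Measure.dirac (Sum.inr ())

lemma lintegral_choiceMeasure (hv : Continuous v) (S : Set Product) {F : Outcome → ENNReal}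
    (hF : Measurable F) :
    ∫⁻ o, F o ∂choiceMeasure v S =
      (∫⁻ x in S, ENNReal.ofReal (v x) * F (Sum.inl x)) + F (Sum.inr ()) := by
  have hFl : Measurable fun x : Product => F (Sum.inl x) := hF.comp measurable_inl
  rw [choiceMeasure, lintegral_add_measure, lintegral_map hF measurable_inl,
    lintegral_withDensity_eq_lintegral_mul _ (continuous_pref hv).measurable.ennreal_ofReal
      hFl, lintegral_dirac' _ hF]
  rfl

lemma lintegral_purchaseLaw (v : ℝ → ℝ) (S : Set Product) (F : Outcome → ENNReal) :
    ∫⁻ o, F o ∂purchaseLaw v S =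
      (ENNReal.ofReal (1 + ∫ x in S, v x))⁻¹ * ∫⁻ o, F o ∂choiceMeasure v S := by
  rw [purchaseLaw, lintegral_smul_measure]
  rfl

lemma isProbabilityMeasure_purchaseLaw (hv : Continuous v)
    (h0 : ∀ x ∈ Set.Icc (0 : ℝ) 1, 0 ≤ v x) (S : Set Product) :
    IsProbabilityMeasure (purchaseLaw v S) := by
  constructor
  rw [← lintegral_one, lintegral_purchaseLaw, lintegral_choiceMeasure hv S measurable_const]
  simp only [mul_one]
  rw [add_comm _ (1 : ENNReal), ← lintegral_pref hv h0]
  have : 0 ≤ ∫ x in S, v x := integral_nonneg fun x => h0 x x.2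
  refine ENNReal.inv_mul_cancel ?_ ENNReal.ofReal_ne_top
  exact (ENNReal.ofReal_pos.2 (by linarith)).ne'

/-- Lebesgue measure on the assortment offered next, as a kernel from the past outcomes. Its
measurability is exactly what `Policy` requires. -/
noncomputable def offeredKernel (π : Policy c) (t : ℕ) : Kernel (Fin t → Outcome) Product where
  toFun h := volume.restrict (offered π.act t h).1
  measurable' := Measure.measurable_of_measurable_coe _ fun A hA => by
    simp_rw [Measure.restrict_apply hA]
    exact π.measurable_offered t A hA

instance (π : Policy c) (t : ℕ) : IsFiniteKernel (offeredKernel π t) :=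
  ⟨1, ENNReal.one_lt_top, fun h => by
    change (volume.restrict (offered π.act t h).1) Set.univ ≤ 1
    rw [Measure.restrict_apply_univ]
    exact prob_le_one⟩

lemma measurable_integral_offered (π : Policy c) (t : ℕ) {f : Product → ℝ} (hf : Continuous f) :
    Measurable fun h => ∫ x in (offered π.act t h).1, f x := by
  have hf' : StronglyMeasurable (Function.uncurry fun (_ : Fin t → Outcome) x => f x) :=
    hf.stronglyMeasurable.comp_measurable measurable_snd
  exact (hf'.integral_kernel_prod_right (κ := offeredKernel π t)).measurable

lemma measurable_purchaseLaw (hv : Continuous v) (π : Policy c) (t : ℕ) :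
    Measurable fun h : Fin t → Outcome => purchaseLaw v (offered π.act t h).1 := by
  refine Measure.measurable_of_measurable_coe _ fun A hA => ?_
  have h : ∀ h : Fin t → Outcome, purchaseLaw v (offered π.act t h).1 A =
      (ENNReal.ofReal (1 + ∫ x in (offered π.act t h).1, v x))⁻¹ *
        ((∫⁻ x, ENNReal.ofReal (v x) * A.indicator 1 (Sum.inl x) ∂(offeredKernel π t h)) +
          A.indicator 1 (Sum.inr ())) := by
    intro h
    have hA' : Measurable (A.indicator (1 : Outcome → ENNReal)) :=
      measurable_one.indicator hA
    rw [← lintegral_indicator_one hA, lintegral_purchaseLaw, lintegral_choiceMeasure hv _ hA']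
    rfl
  simp_rw [h]
  refine ((measurable_integral_offered π t (continuous_pref hv)).const_add
    1).ennreal_ofReal.inv.mul (Measurable.add_const ?_ _)
  refine Measurable.lintegral_kernel ?_
  exact (continuous_pref hv).measurable.ennreal_ofReal.mul
    ((measurable_one.indicator hA).comp measurable_inl)

/-- The law of the next outcome given the past, as a kernel. -/
noncomputable def purchaseKernel (hv : Continuous v) (π : Policy c) (t : ℕ) :
    Kernel (Fin t → Outcome) Outcome where
  toFun h := purchaseLaw v (offered π.act t h).1
  measurable' := measurable_purchaseLaw hv π t

lemma isMarkovKernel_purchaseKernel (hv : Continuous v)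
    (h0 : ∀ x ∈ Set.Icc (0 : ℝ) 1, 0 ≤ v x) (π : Policy c) (t : ℕ) :
    IsMarkovKernel (purchaseKernel hv π t) :=
  ⟨fun _ => isProbabilityMeasure_purchaseLaw hv h0 _⟩

lemma measurable_snoc (t : ℕ) :
    Measurable fun p : (Fin t → Outcome) × Outcome =>
      (Fin.snoc (α := fun _ => Outcome) p.1 p.2 : Fin (t + 1) → Outcome) := by
  refine measurable_pi_lambda _ fun i => ?_
  refine Fin.lastCases ?_ (fun j => ?_) i
  · simpa using measurable_snd
  · simp only [Fin.snoc_castSucc]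
    exact (measurable_pi_apply j).comp measurable_fst

lemma lintegral_outcomeLaw_succ (hv : Continuous v) (h0 : ∀ x ∈ Set.Icc (0 : ℝ) 1, 0 ≤ v x)
    (π : Policy c) (t : ℕ) {F : (Fin (t + 1) → Outcome) → ENNReal} (hF : Measurable F) :
    ∫⁻ h, F h ∂outcomeLaw v π (t + 1) =
      ∫⁻ h, ∫⁻ x, F (Fin.snoc (α := fun _ => Outcome) h x)
        ∂purchaseLaw v (offered π.act t h).1 ∂outcomeLaw v π t := by
  have := isMarkovKernel_purchaseKernel hv h0 π t
  have hsnoc : ∀ h : Fin t → Outcome, Measurable fun x : Outcome =>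
      (Fin.snoc (α := fun _ => Outcome) h x : Fin (t + 1) → Outcome) := fun h =>
    (measurable_snoc t).comp measurable_prodMk_left
  have hmeas : Measurable fun h : Fin t → Outcome =>
      (purchaseLaw v (offered π.act t h).1).map fun x =>
        (Fin.snoc (α := fun _ => Outcome) h x : Fin (t + 1) → Outcome) := by
    refine Measure.measurable_of_measurable_coe _ fun A hA => ?_
    simp_rw [fun h => Measure.map_apply (μ := purchaseLaw v (offered π.act t h).1) (hsnoc h) hA]
    exact Kernel.measurable_kernel_prodMk_left (κ := purchaseKernel hv π t)
      (measurable_snoc t hA)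
  rw [outcomeLaw, Measure.lintegral_bind hmeas.aemeasurable hF.aemeasurable]
  exact lintegral_congr fun h => lintegral_map hF (hsnoc h)

lemma measurable_lintegral_purchaseLaw (hv : Continuous v)
    (h0 : ∀ x ∈ Set.Icc (0 : ℝ) 1, 0 ≤ v x)
    (π : Policy c) (t : ℕ) {F : (Fin (t + 1) → Outcome) → ENNReal} (hF : Measurable F) :
    Measurable fun h => ∫⁻ x, F (Fin.snoc (α := fun _ => Outcome) h x)
        ∂purchaseLaw v (offered π.act t h).1 := by
  have := isMarkovKernel_purchaseKernel hv h0 π t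
  exact Measurable.lintegral_kernel_prod_right' (κ := purchaseKernel hv π t)
    (hF.comp (measurable_snoc t))

lemma isProbabilityMeasure_outcomeLaw (hv : Continuous v)
    (h0 : ∀ x ∈ Set.Icc (0 : ℝ) 1, 0 ≤ v x) (π : Policy c) (t : ℕ) :
    IsProbabilityMeasure (outcomeLaw v π t) := by
  induction t with
  | zero => rw [outcomeLaw]; infer_instance
  | succ t ih =>
    constructor
    rw [← lintegral_one, lintegral_outcomeLaw_succ hv h0 π t measurable_const]
    have := isProbabilityMeasure_purchaseLaw hv h0
    simp

/-- The Cauchy-Schwarz inequality for lower Lebesgue integrals. -/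
lemma sq_lintegral_mul_le {Ω : Type*} [MeasurableSpace Ω] (μ : Measure Ω) {f g : Ω → ENNReal}
    (hf : Measurable f) (hg : Measurable g) :
    (∫⁻ x, f x * g x ∂μ) ^ 2 ≤ (∫⁻ x, f x ^ 2 ∂μ) * ∫⁻ x, g x ^ 2 ∂μ := by
  have h := ENNReal.lintegral_mul_le_Lp_mul_Lq μ Real.HolderConjugate.two_two hf.aemeasurable
    hg.aemeasurable
  simp only [Pi.mul_apply, ENNReal.rpow_two] at h
  refine (pow_le_pow_left' h 2).trans_eq ?_
  rw [mul_pow, ← ENNReal.rpow_two, ← ENNReal.rpow_two, ← ENNReal.rpow_mul, ← ENNReal.rpow_mul]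
  norm_num

/-- The chi-squared divergence of one purchase: the second moment of the likelihood ratio of
`purchaseLaw v' S` and `purchaseLaw v S` is at most `1 + ε`. -/
lemma sq_lintegral_purchaseLaw_le (hv : Continuous v) (hv' : Continuous v')
    (h0 : ∀ x ∈ Set.Icc (0 : ℝ) 1, 0 < v x) (h0' : ∀ x ∈ Set.Icc (0 : ℝ) 1, 0 ≤ v' x)
    (S : Set Product) {ε : ℝ} (hε0 : 0 ≤ ε)
    (hε : (1 + ∫ x in S, v x) * (∫ x in S, (v' x - v x) ^ 2 / v x) ≤
      ε * (1 + ∫ x in S, v' x) ^ 2)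
    {F : Outcome → ENNReal} (hF : Measurable F) :
    (∫⁻ o, F o ∂purchaseLaw v' S) ^ 2 ≤
      ENNReal.ofReal (1 + ε) * ∫⁻ o, F o ^ 2 ∂purchaseLaw v S := by
  set ρ : Product → ℝ := fun x => v' x / v x with hρ
  have cv := continuous_pref hv
  have cv' := continuous_pref hv'
  have hne : ∀ x : Product, v x ≠ 0 := fun x => (h0 x x.2).ne'
  have cρ : Continuous ρ := cv'.div cv hne
  have hρ0 : ∀ x, 0 ≤ ρ x := fun x => div_nonneg (h0' x x.2) (h0 x x.2).le
  have hV : 0 ≤ ∫ x in S, v x := integral_nonneg fun x => (h0 x x.2).le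
  have hV' : 0 ≤ ∫ x in S, v' x := integral_nonneg fun x => h0' x x.2
  -- the likelihood ratio of the unnormalized laws
  set L : Outcome → ENNReal := Sum.elim (fun x => ENNReal.ofReal (ρ x)) fun _ => 1 with hL
  have mL : Measurable L := cρ.measurable.ennreal_ofReal.sumElim measurable_const
  have mFL : Measurable fun o => F o * L o := hF.mul mL
  have e1 : ∫⁻ o, F o ∂choiceMeasure v' S = ∫⁻ o, F o * L o ∂choiceMeasure v S := by
    rw [lintegral_choiceMeasure hv' S hF, lintegral_choiceMeasure hv S mFL]
    simp only [hL, Sum.elim_inl, Sum.elim_inr, mul_one]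
    congr 1
    refine lintegral_congr fun x => ?_
    rw [mul_comm (F _), ← mul_assoc, ← ENNReal.ofReal_mul (h0 x x.2).le, hρ,
      mul_div_cancel₀ _ (hne x)]
  have e2 : ∫⁻ o, L o ^ 2 ∂choiceMeasure v S =
      ENNReal.ofReal (1 + ∫ x in S, v x * ρ x ^ 2) := by
    rw [lintegral_choiceMeasure hv S (mL.pow_const 2)]
    have hnn : ∀ x : Product, 0 ≤ v x * ρ x ^ 2 := fun x =>
      mul_nonneg (h0 x x.2).le (sq_nonneg _)
    have i0 : IntegrableOn (fun x : Product => v x * ρ x ^ 2) S :=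
      integrableOn_pref (cv.mul (cρ.pow 2)) S
    rw [ENNReal.ofReal_add zero_le_one (integral_nonneg hnn), ENNReal.ofReal_one, add_comm,
      ofReal_integral_eq_lintegral_ofReal i0 (Filter.Eventually.of_forall hnn)]
    simp only [hL, Sum.elim_inl, Sum.elim_inr, one_pow]
    congr 1
    refine lintegral_congr fun x => ?_
    rw [ENNReal.ofReal_mul (h0 x x.2).le, ENNReal.ofReal_pow (hρ0 x)]
  -- `v'² / v = 2 v' - v + (v' - v)² / v`
  have e3 : ∫ x in S, v x * ρ x ^ 2 =
      2 * (∫ x in S, v' x) - (∫ x in S, v x) + ∫ x in S, (v' x - v x) ^ 2 / v x := by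
    have hpt : ∀ x : Product, v x * ρ x ^ 2 = 2 * v' x - v x + (v' x - v x) ^ 2 / v x := by
      intro x
      have := hne x
      simp only [hρ]
      field_simp
      ring
    simp_rw [hpt]
    have i1 := integrableOn_pref cv S
    have i2 : IntegrableOn (fun x : Product => 2 * v' x) S :=
      (integrableOn_pref cv' S).const_mul 2
    have i3 : IntegrableOn (fun x : Product => (v' x - v x) ^ 2 / v x) S :=
      integrableOn_pref (((cv'.sub cv).pow 2).div cv hne) S
    have i4 : IntegrableOn (fun x : Product => 2 * v' x - v x) S := i2.sub i1
    rw [integral_add i4 i3, integral_sub i2 i1, integral_const_mul]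
  set V := ∫ x in S, v x
  set V' := ∫ x in S, v' x
  set q := ∫ x in S, (v' x - v x) ^ 2 / v x
  have key : (1 + V) * (1 + (2 * V' - V + q)) ≤ (1 + ε) * (1 + V') ^ 2 := by
    nlinarith [sq_nonneg (V' - V)]
  have cs := sq_lintegral_mul_le (choiceMeasure v S) hF mL
  rw [← e1, e2, e3] at cs
  rw [lintegral_purchaseLaw, lintegral_purchaseLaw, mul_pow]
  set z := ENNReal.ofReal (1 + V)
  set z' := ENNReal.ofReal (1 + V')
  have hz0 : z ≠ 0 := (ENNReal.ofReal_pos.2 (by linarith)).ne'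
  have hz0' : z' ≠ 0 := (ENNReal.ofReal_pos.2 (by linarith)).ne'
  have hzt : z ≠ ⊤ := ENNReal.ofReal_ne_top
  have hzt' : z' ≠ ⊤ := ENNReal.ofReal_ne_top
  set B := ∫⁻ o, F o ^ 2 ∂choiceMeasure v S
  have keyE : z * ENNReal.ofReal (1 + (2 * V' - V + q)) ≤ ENNReal.ofReal (1 + ε) * z' ^ 2 := by
    rw [← ENNReal.ofReal_mul (by linarith), ← ENNReal.ofReal_pow (by linarith),
      ← ENNReal.ofReal_mul (by linarith)]
    exact ENNReal.ofReal_le_ofReal key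
  calc z'⁻¹ ^ 2 * (∫⁻ o, F o ∂choiceMeasure v' S) ^ 2
      ≤ z'⁻¹ ^ 2 * (B * ENNReal.ofReal (1 + (2 * V' - V + q))) := by gcongr
    _ = z'⁻¹ ^ 2 * (z⁻¹ * B * (z * ENNReal.ofReal (1 + (2 * V' - V + q)))) := by
      congr 1
      calc _ = (z⁻¹ * z) * (B * ENNReal.ofReal (1 + (2 * V' - V + q))) := by
            rw [ENNReal.inv_mul_cancel hz0 hzt, one_mul]
        _ = _ := by ring
    _ ≤ z'⁻¹ ^ 2 * (z⁻¹ * B * (ENNReal.ofReal (1 + ε) * z' ^ 2)) := by gcongr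
    _ = (z'⁻¹ * z') ^ 2 * (ENNReal.ofReal (1 + ε) * (z⁻¹ * B)) := by ring
    _ = _ := by rw [ENNReal.inv_mul_cancel hz0' hzt', one_pow, one_mul]

/-- The second moment of the likelihood ratio is submultiplicative along a policy. Phrased
through test functions, this requires no density of the joint laws. -/
lemma sq_lintegral_outcomeLaw_le (hv : Continuous v) (hv' : Continuous v')
    (h0 : ∀ x ∈ Set.Icc (0 : ℝ) 1, 0 ≤ v x) (h0' : ∀ x ∈ Set.Icc (0 : ℝ) 1, 0 ≤ v' x)
    {R : ENNReal} (hR : ∀ S : Set Product, ∀ F : Outcome → ENNReal, Measurable F →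
      (∫⁻ o, F o ∂purchaseLaw v' S) ^ 2 ≤ R * ∫⁻ o, F o ^ 2 ∂purchaseLaw v S)
    (π : Policy c) (t : ℕ) {F : (Fin t → Outcome) → ENNReal} (hF : Measurable F) :
    (∫⁻ h, F h ∂outcomeLaw v' π t) ^ 2 ≤ R ^ t * ∫⁻ h, F h ^ 2 ∂outcomeLaw v π t := by
  induction t with
  | zero =>
    rw [outcomeLaw, outcomeLaw, lintegral_dirac' _ hF, lintegral_dirac' _ (hF.pow_const 2)]
    simp
  | succ t ih =>
    rw [lintegral_outcomeLaw_succ hv' h0' π t hF,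
      lintegral_outcomeLaw_succ hv h0 π t (hF.pow_const 2)]
    refine (ih (measurable_lintegral_purchaseLaw hv' h0' π t hF)).trans ?_
    rw [pow_succ, mul_assoc]
    gcongr
    rw [← lintegral_const_mul _ (measurable_lintegral_purchaseLaw hv h0 π t (hF.pow_const 2))]
    refine lintegral_mono fun h => hR _ _ ?_
    exact hF.comp ((measurable_snoc t).comp measurable_prodMk_left)

/-- If the likelihood ratio of `P'` and `P` has second moment at most `1 + l ^ 2`, then the means
of a `[0,1]`-valued function differ by at most `l`; the test function `1 + l (f - ∫ f ∂P)`
shows it. -/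
lemma integral_le_add_of_sq_lintegral_le {Ω : Type*} [MeasurableSpace Ω] {P P' : Measure Ω}
    [IsProbabilityMeasure P] [IsProbabilityMeasure P'] {l : ℝ} (hl0 : 0 < l) (hl1 : l ≤ 1)
    (hR : ∀ F : Ω → ENNReal, Measurable F →
      (∫⁻ x, F x ∂P') ^ 2 ≤ ENNReal.ofReal (1 + l ^ 2) * ∫⁻ x, F x ^ 2 ∂P)
    {f : Ω → ℝ} (hf : Measurable f) (hf01 : ∀ x, f x ∈ Set.Icc (0 : ℝ) 1) :
    ∫ x, f x ∂P' ≤ ∫ x, f x ∂P + l := by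
  have hint : ∀ Q : Measure Ω, IsProbabilityMeasure Q → Integrable f Q := fun Q _ =>
    Integrable.of_bound hf.aestronglyMeasurable 1 (Filter.Eventually.of_forall fun x => by
      rw [Real.norm_eq_abs, abs_of_nonneg (hf01 x).1]
      exact (hf01 x).2)
  set m := ∫ x, f x ∂P with hm
  have hm0 : 0 ≤ m := integral_nonneg fun x => (hf01 x).1
  have hm1 : m ≤ 1 := by
    refine (integral_mono (hint P ‹_›) (integrable_const 1) fun x => (hf01 x).2).trans ?_
    simp
  set g : Ω → ℝ := fun x => 1 + l * (f x - m) with hg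
  have mg : Measurable g := ((hf.sub_const m).const_mul l).const_add 1
  have hg0 : ∀ x, 0 ≤ g x := fun x => by
    have := (hf01 x).1
    simp only [hg]
    nlinarith
  have ig : ∀ Q : Measure Ω, IsProbabilityMeasure Q → Integrable g Q := fun Q hQ =>
    (integrable_const 1).add (((hint Q hQ).sub (integrable_const m)).const_mul l)
  have eg : ∀ Q : Measure Ω, IsProbabilityMeasure Q →
      ∫ x, g x ∂Q = 1 + l * (∫ x, f x ∂Q - m) := fun Q hQ => by
    have i1 : Integrable (fun x => l * (f x - m)) Q :=
      ((hint Q hQ).sub (integrable_const m)).const_mul l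
    simp only [hg]
    rw [integral_add (integrable_const 1) i1,
      integral_const_mul, integral_sub (hint Q hQ) (integrable_const m)]
    simp
  have hsq : ∫ x, g x ^ 2 ∂P ≤ 1 + l ^ 2 := by
    have hle : ∀ x, g x ^ 2 ≤ (2 * g x - 1) + l ^ 2 := fun x => by
      have h1 := (hf01 x).1
      have h2 := (hf01 x).2
      have : (f x - m) ^ 2 ≤ 1 := by nlinarith
      simp only [hg]
      nlinarith [sq_nonneg l]
    have i1 : Integrable (fun x => 2 * g x - 1) P :=
      ((ig P ‹_›).const_mul 2).sub (integrable_const 1)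
    have h := integral_mono_of_nonneg (μ := P) (Filter.Eventually.of_forall fun x =>
      sq_nonneg (g x)) (i1.add (integrable_const (l ^ 2))) (Filter.Eventually.of_forall hle)
    refine h.trans_eq ?_
    change ∫ x, ((2 * g x - 1) + l ^ 2) ∂P = _
    rw [integral_add i1 (integrable_const _), integral_sub ((ig P ‹_›).const_mul 2)
      (integrable_const 1), integral_const_mul, eg P ‹_›]
    simp
    ring
  have ig2 : Integrable (fun x => g x ^ 2) P := by
    refine Integrable.of_bound (mg.pow_const 2).aestronglyMeasurable 4
      (Filter.Eventually.of_forall fun x => ?_)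
    have h2 := (hf01 x).2
    have : g x ≤ 2 := by
      simp only [hg]
      nlinarith
    rw [Real.norm_eq_abs, abs_of_nonneg (sq_nonneg _)]
    nlinarith [hg0 x]
  have h := hR (fun x => ENNReal.ofReal (g x)) mg.ennreal_ofReal
  simp_rw [← ENNReal.ofReal_pow (hg0 _)] at h
  rw [← ofReal_integral_eq_lintegral_ofReal (ig P' ‹_›) (Filter.Eventually.of_forall hg0),
    ← ofReal_integral_eq_lintegral_ofReal ig2 (Filter.Eventually.of_forall fun x => sq_nonneg _),
    ← ENNReal.ofReal_pow (integral_nonneg hg0), ← ENNReal.ofReal_mul (by positivity),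
    ENNReal.ofReal_le_ofReal_iff (mul_nonneg (by positivity)
      (integral_nonneg fun x => sq_nonneg _)), eg P' ‹_›] at h
  by_contra! hlt
  have h1 : 1 + l ^ 2 < 1 + l * (∫ x, f x ∂P' - m) := by nlinarith
  have h2 : (1 + l ^ 2) ^ 2 < (1 + l * (∫ x, f x ∂P' - m)) ^ 2 :=
    pow_lt_pow_left₀ h1 (by positivity) two_ne_zero
  nlinarith [sq_nonneg l]

/-! ### Bins and the revenue loss of an assortment -/

/-- The `i`-th bin `[c (i - 1) / K, c i / K)`, as a set of products. -/
def bin (c : ℝ) (K i : ℕ) : Set Product :=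
  Subtype.val ⁻¹' Set.Ico (c * (i - 1) / K) (c * i / K)

lemma measurableSet_bin (i : ℕ) : MeasurableSet (bin c K i) :=
  measurable_subtype_coe measurableSet_Ico

lemma setIntegral_bin (hc0 : 0 < c) {i : ℕ} (hi1 : 1 ≤ i) (hi : c * i ≤ K) (f : ℝ → ℝ) :
    ∫ x in bin c K i, f x = ∫ x in (c * (i - 1) / K)..(c * i / K), f x := by
  have hi1' : (1 : ℝ) ≤ i := by exact_mod_cast hi1
  have hK : (0 : ℝ) < K := by nlinarith
  have hmp : MeasurePreserving (Subtype.val : Product → ℝ) volume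
      (volume.restrict (Set.Icc 0 1)) := measurePreserving_subtype_coe measurableSet_Icc
  rw [bin, hmp.setIntegral_preimage_emb (MeasurableEmbedding.subtype_coe measurableSet_Icc) f,
    Measure.restrict_restrict measurableSet_Ico, Set.inter_eq_left.2]
  · rw [intervalIntegral.integral_of_le (by gcongr; linarith), integral_Ico_eq_integral_Ioc]
  · refine fun x hx => ⟨le_trans ?_ hx.1, hx.2.le.trans ?_⟩
    · exact div_nonneg (mul_nonneg hc0.le (by linarith)) hK.le
    · rwa [div_le_one hK]

lemma volume_bin (hc0 : 0 < c) {i : ℕ} (hi1 : 1 ≤ i) (hi : c * i ≤ K) :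
    volume.real (bin c K i) = c / K := by
  have h := setIntegral_bin hc0 hi1 hi (fun _ => 1)
  simp only [setIntegral_const, smul_eq_mul, mul_one, intervalIntegral.integral_const] at h
  rw [h]
  ring

lemma abs_le_of_mem_bin (hc0 : 0 < c) (hK : 0 < K) {i : ℕ} {x : Product} (hx : x ∈ bin c K i) :
    |2 * K * (x : ℝ) / c + 1 - 2 * (i : ℤ)| ≤ 1 := by
  have hK' : (0 : ℝ) < K := by exact_mod_cast hK
  obtain ⟨h1, h2⟩ := hx
  rw [div_le_iff₀ hK'] at h1
  rw [lt_div_iff₀ hK'] at h2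
  have h3 : (i : ℝ) - 1 ≤ K * x / c := by
    rw [le_div_iff₀ hc0]
    linarith
  have h4 : K * (x : ℝ) / c ≤ i := by
    rw [div_le_iff₀ hc0]
    linarith
  have h5 : 2 * K * (x : ℝ) / c = 2 * (K * x / c) := by ring
  rw [h5, abs_le]
  push_cast
  constructor <;> linarith

lemma disjoint_bin (hc0 : 0 < c) (hK : 0 < K) {i j : ℕ} (hij : i ≠ j) :
    Disjoint (bin c K i) (bin c K j) := by
  have hK' : (0 : ℝ) < K := by exact_mod_cast hK
  have aux : ∀ {i j : ℕ}, i < j → Disjoint (bin c K i) (bin c K j) := by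
    intro i j h
    refine Set.disjoint_left.2 fun x hi hj => ?_
    have h1 : (i : ℝ) + 1 ≤ j := by exact_mod_cast h
    have h2 := hi.2.trans_le' hj.1
    rw [div_lt_div_iff_of_pos_right hK'] at h2
    nlinarith
  rcases lt_or_gt_of_ne hij with h | h
  · exact aux h
  · exact (aux h).symm

lemma exists_mem_bin (hc0 : 0 < c) (hK : 0 < K) (x : Product) : ∃ i, x ∈ bin c K i := by
  have hK' : (0 : ℝ) < K := by exact_mod_cast hK
  have h0 : 0 ≤ K * (x : ℝ) / c := div_nonneg (mul_nonneg hK'.le x.2.1) hc0.le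
  refine ⟨⌊K * (x : ℝ) / c⌋₊ + 1, ?_, ?_⟩
  · have := Nat.floor_le h0
    rw [le_div_iff₀ hc0] at this
    rw [div_le_iff₀ hK']
    push_cast
    linarith
  · have := Nat.lt_floor_add_one (K * (x : ℝ) / c)
    rw [div_lt_iff₀ hc0] at this
    rw [lt_div_iff₀ hK']
    push_cast
    linarith

lemma sum_volume_inter_bin_le (hc0 : 0 < c) (hK : 0 < K) (s : Finset ℕ) (S : Set Product) :
    ∑ i ∈ s, volume.real (bin c K i ∩ S) ≤ volume.real S := by
  have h := measureReal_biUnion_finset (μ := volume.restrict S) (s := s)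
    (f := fun i => bin c K i) (fun i _ j _ hij => disjoint_bin hc0 hK hij)
    (fun i _ => measurableSet_bin i)
  simp_rw [fun i => measureReal_restrict_apply (μ := volume) (s := S)
    (measurableSet_bin (c := c) (K := K) i)] at h
  rw [← h]
  exact (measureReal_mono (Set.subset_univ _)).trans_eq (measureReal_restrict_apply_univ _)

lemma setIntegral_binBump_bin (hc0 : 0 < c) {i : ℕ} (hi1 : 1 ≤ i) (hi : c * i ≤ K) :
    99 / 200 * (c / K) ^ 2 ≤ ∫ x in bin c K i, binBump c K i x := by
  have hi1' : (1 : ℝ) ≤ i := by exact_mod_cast hi1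
  have hK : (0 : ℝ) < K := by nlinarith
  have hne : 2 * K / c ≠ 0 := by positivity
  rw [setIntegral_bin hc0 hi1 hi]
  simp_rw [binBump]
  have h : ∀ x : ℝ, 2 * K * x / c - 2 * i + 1 = 2 * K / c * x + (1 - 2 * i) := fun x => by ring
  simp_rw [h]
  rw [intervalIntegral.integral_const_mul, intervalIntegral.integral_comp_mul_add _ hne]
  have e1 : 2 * K / c * (c * (i - 1) / K) + (1 - 2 * i) = -1 := by
    field_simp
    ring
  have e2 : 2 * K / c * (c * i / K) + (1 - 2 * i) = 1 := by
    field_simp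
    ring
  rw [e1, e2, smul_eq_mul, inv_div]
  have hb := integral_bump_bin
  calc 99 / 200 * (c / K) ^ 2 = c / K * (c / (2 * K) * (99 / 100)) := by
        field_simp
        ring
    _ ≤ _ := by gcongr

lemma setIntegral_binBump_le (hc0 : 0 < c) (hK : 0 < K) (i : ℕ) (S : Set Product) :
    ∫ x in S, binBump c K i x ≤ 1 / 2 * (c / K) ^ 2 := by
  have hK' : (0 : ℝ) < K := by exact_mod_cast hK
  have hint : Integrable (binBump c K i) := by
    unfold binBump
    have h : ∀ x : ℝ, 2 * K * x / c - 2 * i + 1 = 2 * K / c * x + (1 - 2 * i) := fun x => by ring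
    simp_rw [h]
    exact ((integrable_bump.comp_add_right (1 - 2 * i : ℝ)).comp_mul_left'
      (by positivity : 2 * K / c ≠ 0)).const_mul _
  have htot : ∫ x, binBump c K i x = 1 / 2 * (c / K) ^ 2 := by
    unfold binBump
    have h : ∀ x : ℝ, 2 * K * x / c - 2 * i + 1 = 2 * K / c * x + (1 - 2 * i) := fun x => by ring
    simp_rw [h]
    rw [integral_const_mul, Measure.integral_comp_mul_left (fun y => bump (y + (1 - 2 * i))),
      integral_add_right_eq_self, integral_bump, inv_div, abs_of_pos (by positivity)]
    simp only [smul_eq_mul, mul_one]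
    field_simp
  have hc := integrableOn_pref (continuous_pref (continuous_binBump (c := c) (K := K) i))
  calc ∫ x in S, binBump c K i x ≤ ∫ x : Product, binBump c K i x :=
        setIntegral_le_integral ((hc Set.univ).integrable_of_forall_notMem_eq_zero (by simp))
          (Filter.Eventually.of_forall fun x => binBump_nonneg hc0 i _)
    _ = ∫ x in Set.Icc (0 : ℝ) 1, binBump c K i x := integral_subtype measurableSet_Icc _
    _ ≤ ∫ x, binBump c K i x := setIntegral_le_integral hint
          (Filter.Eventually.of_forall fun x => binBump_nonneg hc0 i x)
    _ = _ := htot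

/-- Up to negligible tails, the bumps of `I` are bounded by their peak on the bins of `I` and
vanish elsewhere. -/
lemma sum_binBump_le_indicator (hc0 : 0 < c) (hK : 0 < K) (I : Finset ℕ) (x : Product) :
    ∑ j ∈ I, binBump c K j x ≤
      c / K * (1 / 50 + 4 / 3 * ∑ j ∈ I, (bin c K j).indicator 1 x) := by
  obtain ⟨i, hi⟩ := exists_mem_bin hc0 hK x
  have habs := abs_le_of_mem_bin hc0 hK hi
  have hpos : 0 ≤ c / K := by positivity
  by_cases hI : i ∈ I
  · have h1 := sum_binBump_tail_le hc0 habs (I.erase i)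
      fun j hj => by exact_mod_cast Finset.ne_of_mem_erase hj
    have h2 : (1 : ℝ) ≤ ∑ j ∈ I, (bin c K j).indicator 1 x := by
      refine le_trans ?_ (Finset.single_le_sum (f := fun j => (bin c K j).indicator 1 x)
        (fun j _ => Set.indicator_nonneg (fun _ _ => zero_le_one) x) hI)
      simp [hi]
    rw [← Finset.add_sum_erase I _ hI]
    have h3 := binBump_le (K := K) hc0 i x
    nlinarith
  · have h1 := sum_binBump_tail_le hc0 habs I fun j hj h => hI (by
      have : j = i := by exact_mod_cast h
      rwa [← this])
    have h2 : (0 : ℝ) ≤ ∑ j ∈ I, (bin c K j).indicator 1 x :=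
      Finset.sum_nonneg fun j _ => Set.indicator_nonneg (fun _ _ => zero_le_one) x
    nlinarith

lemma setIntegral_sum_binBump_le (hc0 : 0 < c) (hK : 0 < K) (I : Finset ℕ) (S : Set Product) :
    ∫ x in S, ∑ j ∈ I, binBump c K j x ≤
      c / K * (1 / 50 * volume.real S + 4 / 3 * ∑ j ∈ I, volume.real (bin c K j ∩ S)) := by
  have hb := fun j => continuous_binBump (c := c) (K := K) j
  have hind : ∀ j, Integrable ((bin c K j).indicator (1 : Product → ℝ)) (volume.restrict S) :=
    fun j => (integrable_const (1 : ℝ)).indicator (measurableSet_bin j)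
  have i1 : Integrable (fun x => ∑ j ∈ I, (bin c K j).indicator (1 : Product → ℝ) x)
      (volume.restrict S) := integrable_finsetSum _ fun j _ => hind j
  have i2 := i1.const_mul (4 / 3)
  have h := integral_mono (μ := volume.restrict S)
    (integrableOn_pref (continuous_pref (v := fun x => ∑ j ∈ I, binBump c K j x)
      (by fun_prop)) S)
    (((integrable_const (1 / 50 : ℝ)).add i2).const_mul (c / K))
    fun x => sum_binBump_le_indicator hc0 hK I x
  refine h.trans_eq ?_
  rw [integral_const_mul, integral_add' (integrable_const (1 / 50 : ℝ)) i2,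
    integral_const_mul, integral_finsetSum _ fun j _ => hind j]
  simp_rw [integral_indicator_one (measurableSet_bin _),
    measureReal_restrict_apply (measurableSet_bin _)]
  simp [mul_comm]

/-- The gain `∫_S v (w - s) - s` of an assortment `S` over the revenue level `s`, for the
perturbed preferences. -/
noncomputable def gain (c : ℝ) (K : ℕ) (I : Finset ℕ) (S : Set Product) : ℝ :=
  4 / 5 * ((1 - betaPar c K) * volume.real S + (∫ x in S, ∑ i ∈ I, binBump c K i x) - c)

lemma setIntegral_perturbed_nonneg (hc0 : 0 < c) (hc1 : c ≤ 1 / 4) (hK : 2 ≤ K) (I : Finset ℕ)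
    (S : Set Product) : 0 ≤ ∫ x in S, perturbed c K I x :=
  integral_nonneg fun x => by
    have := (perturbed_bounds hc0 hc1 hK I x.2).1
    change 0 ≤ perturbed c K I x
    linarith

lemma revenue_perturbed (hc0 : 0 < c) (hc1 : c ≤ 1 / 4) (hK : 2 ≤ K) (I : Finset ℕ)
    (S : Set Product) :
    revenue (margin c) (perturbed c K I) S =
      sPar c + gain c K I S / (1 + ∫ x in S, perturbed c K I x) := by
  have hb := fun j => continuous_binBump (c := c) (K := K) j
  have hV := setIntegral_perturbed_nonneg hc0 hc1 hK I S
  have i1 : IntegrableOn (fun x : Product => sPar c * perturbed c K I x) S :=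
    (integrableOn_pref (continuous_pref (continuous_perturbed hc0 I)) S).const_mul _
  have i2 : IntegrableOn (fun x : Product => ∑ i ∈ I, binBump c K i x) S :=
    integrableOn_pref (continuous_pref (v := fun x => ∑ j ∈ I, binBump c K j x) (by fun_prop)) S
  have i3 : IntegrableOn (fun _ : Product => 1 - betaPar c K) S := integrableOn_const (by simp)
  have i4 : IntegrableOn (fun x : Product =>
      4 / 5 * (1 - betaPar c K + ∑ i ∈ I, binBump c K i x)) S := (i3.add i2).const_mul _
  have h : ∫ x in S, perturbed c K I x * margin c x =
      sPar c * (∫ x in S, perturbed c K I x) +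
        4 / 5 * ((1 - betaPar c K) * volume.real S + ∫ x in S, ∑ i ∈ I, binBump c K i x) := by
    have hpt : ∀ x : Product, perturbed c K I x * margin c x = sPar c * perturbed c K I x +
        4 / 5 * (1 - betaPar c K + ∑ i ∈ I, binBump c K i x) := fun x => by
      rw [perturbed_mul_margin hc0 hc1 I x.2]
      ring
    simp_rw [hpt]
    rw [integral_add i1 i4, integral_const_mul, integral_const_mul, integral_add i3 i2,
      setIntegral_const, smul_eq_mul, mul_comm (volume.real S)]
  rw [revenue, h, gain, sPar]
  have : 1 + ∫ x in S, perturbed c K I x ≠ 0 := by linarith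
  field_simp
  ring

lemma continuous_margin : Continuous fun x : Product => margin c x := by
  simp_rw [margin_eq]
  refine ((continuous_const).div (by fun_prop) fun x => ?_).add continuous_const
  have := x.2.2
  linarith

lemma revenue_nonneg (hc0 : 0 < c) (hc1 : c ≤ 1 / 4) (hK : 2 ≤ K) (I : Finset ℕ)
    (S : Set Product) : 0 ≤ revenue (margin c) (perturbed c K I) S := by
  refine div_nonneg (integral_nonneg fun x => mul_nonneg ?_ (margin_mem hc0 hc1 x.2).1)
    (add_nonneg zero_le_one (setIntegral_perturbed_nonneg hc0 hc1 hK I S))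
  have := (perturbed_bounds hc0 hc1 hK I x.2).1
  linarith

lemma revenue_le_one (hc0 : 0 < c) (hc1 : c ≤ 1 / 4) (hK : 2 ≤ K) (I : Finset ℕ)
    (S : Set Product) : revenue (margin c) (perturbed c K I) S ≤ 1 := by
  have hV := setIntegral_perturbed_nonneg hc0 hc1 hK I S
  rw [revenue, div_le_one (by linarith)]
  have cv := continuous_pref (continuous_perturbed (K := K) hc0 I)
  have h := integral_mono (μ := volume.restrict S) (integrableOn_pref (cv.mul continuous_margin) S)
    (integrableOn_pref cv S) fun x => by
      have h1 := (perturbed_bounds hc0 hc1 hK I x.2).1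
      exact mul_le_of_le_one_right (by linarith) (margin_mem hc0 hc1 x.2).2
  simp only [Pi.mul_apply] at h
  linarith

lemma revenue_le_optRevenue (hc0 : 0 < c) (hc1 : c ≤ 1 / 4) (hK : 2 ≤ K) (I : Finset ℕ)
    (S : Assortment c) :
    revenue (margin c) (perturbed c K I) S.1 ≤ optRevenue c (margin c) (perturbed c K I) :=
  le_ciSup (f := fun S : Assortment c => revenue (margin c) (perturbed c K I) S.1)
    ⟨1, by
      rintro _ ⟨S, rfl⟩
      exact revenue_le_one hc0 hc1 hK I S.1⟩ S

lemma setIntegral_perturbed_bounds (hc0 : 0 < c) (hc1 : c ≤ 1 / 4) (hK : 100 ≤ K)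
    (I : Finset ℕ) (S : Set Product) :
    79 / 100 * volume.real S ≤ ∫ x in S, perturbed c K I x ∧
      ∫ x in S, perturbed c K I x ≤ 201 / 100 * volume.real S := by
  have hK' : (100 : ℝ) ≤ K := by exact_mod_cast hK
  have hcK : c / K ≤ 1 / 400 := by
    rw [div_le_iff₀ (by linarith)]
    linarith
  have hi := integrableOn_pref (continuous_pref (continuous_perturbed (K := K) hc0 I)) S
  have hb := fun x : Product => perturbed_bounds hc0 hc1 (by omega : 2 ≤ K) I x.2
  have h1 := integral_mono (μ := volume.restrict S) (integrable_const (79 / 100 : ℝ)) hi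
    fun x => (hb x).1
  have h2 := integral_mono (μ := volume.restrict S) hi (integrable_const (201 / 100 : ℝ))
    fun x => (hb x).2.trans (by linarith)
  simp only [integral_const, measureReal_restrict_apply_univ, smul_eq_mul] at h1 h2
  constructor <;> linarith

lemma volume_biUnion_bin (hc0 : 0 < c) {I : Finset ℕ} (hcard : I.card = K)
    (hI : ∀ i ∈ I, 1 ≤ i ∧ c * i ≤ K) (hK : 0 < K) :
    volume.real (⋃ i ∈ I, bin c K i) = c := by
  have hK' : (K : ℝ) ≠ 0 := by positivity
  rw [measureReal_biUnion_finset (fun i _ j _ hij => disjoint_bin hc0 hK hij)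
    fun i _ => measurableSet_bin i,
    Finset.sum_congr rfl fun i hi => volume_bin hc0 (hI i hi).1 (hI i hi).2,
    Finset.sum_const, hcard, nsmul_eq_mul]
  field_simp

/-- Offering exactly the bins of `I` gains at least a constant times `c ^ 2 / K`. -/
lemma optRevenue_ge (hc0 : 0 < c) (hc1 : c ≤ 1 / 4) (hK : 100 ≤ K) {I : Finset ℕ}
    (hcard : I.card = K) (hI : ∀ i ∈ I, 1 ≤ i ∧ c * i ≤ K) :
    sPar c + 19 / 50 * (c ^ 2 / K) / (1 + 201 / 100 * c) ≤
      optRevenue c (margin c) (perturbed c K I) := by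
  have hK0 : 0 < K := by omega
  have hK' : (0 : ℝ) < K := by exact_mod_cast hK0
  have hvol := volume_biUnion_bin hc0 hcard hI hK0
  set U : Set Product := ⋃ i ∈ I, bin c K i with hU
  have mU : MeasurableSet U := Finset.measurableSet_biUnion I fun i _ => measurableSet_bin i
  have hUc : volume U ≤ ENNReal.ofReal c := by
    rw [← hvol, ofReal_measureReal (measure_ne_top _ _)]
  refine le_trans ?_ (revenue_le_optRevenue hc0 hc1 (by omega) I ⟨U, mU, hUc⟩)
  rw [revenue_perturbed hc0 hc1 (by omega) I]
  have hb := fun j => continuous_binBump (c := c) (K := K) j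
  have hτ : 99 / 200 * (c ^ 2 / K) ≤ ∫ x in U, ∑ i ∈ I, binBump c K i x := by
    rw [hU, integral_biUnion_finset I (fun i _ => measurableSet_bin i)
      (fun i _ j _ hij => disjoint_bin hc0 hK0 hij)
      fun i _ => integrableOn_pref (continuous_pref
        (v := fun x => ∑ j ∈ I, binBump c K j x) (by fun_prop)) _]
    calc 99 / 200 * (c ^ 2 / K) = ∑ i ∈ I, 99 / 200 * (c / K) ^ 2 := by
          rw [Finset.sum_const, hcard, nsmul_eq_mul]
          field_simp
      _ ≤ _ := Finset.sum_le_sum fun i hi =>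
        (setIntegral_binBump_bin hc0 (hI i hi).1 (hI i hi).2).trans <|
          integral_mono (integrableOn_pref (continuous_pref (hb i)) _)
            (integrableOn_pref (continuous_pref
              (v := fun x => ∑ j ∈ I, binBump c K j x) (by fun_prop)) _)
            fun x => Finset.single_le_sum (f := fun j => binBump c K j x)
              (fun j _ => binBump_nonneg hc0 j _) hi
  have hβ := betaPar_le (K := K) hc0
  have hβc : betaPar c K * c ≤ 1 / 50 * (c ^ 2 / K) := by
    calc betaPar c K * c ≤ c / K * (1 / 50) * c := by gcongr
      _ = _ := by ring
  -- `19 / 50 = 4 / 5 * (99 / 200 - 1 / 50)`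
  have hg : 19 / 50 * (c ^ 2 / K) ≤ gain c K I U := by
    rw [gain, hvol]
    linarith
  have hV := (setIntegral_perturbed_bounds hc0 hc1 hK I U).2
  have hV0 := setIntegral_perturbed_nonneg hc0 hc1 (by omega : 2 ≤ K) I U
  rw [hvol] at hV
  gcongr sPar c + ?_
  exact div_le_div₀ (le_trans (by positivity) hg) hg (by linarith) (by linarith)

/-- The loss of an assortment in terms of its overlap with the bins of `I`. Since `v₀` is not
constant, assortments differ in `∫_S v`, which costs the factor
`(1 + 0.79 c) / (1 + 2.01 c) ≥ 0.796`. -/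
lemma optRevenue_sub_revenue_ge (hc0 : 0 < c) (hc1 : c ≤ 1 / 4) (hK : 100 ≤ K) {I : Finset ℕ}
    (hcard : I.card = K) (hI : ∀ i ∈ I, 1 ≤ i ∧ c * i ≤ K) (S : Assortment c) :
    2 / 5 * (c ^ 2 / K) * (179 / 500 - 4 / 3 * ((∑ i ∈ I, volume.real (bin c K i ∩ S.1)) / c)) ≤
      optRevenue c (margin c) (perturbed c K I) - revenue (margin c) (perturbed c K I) S.1 := by
  have hK' : (100 : ℝ) ≤ K := by exact_mod_cast hK
  have hK2 : 2 ≤ K := by omega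
  set y := volume.real S.1
  have hy0 : 0 ≤ y := measureReal_nonneg
  have hyc : y ≤ c := by
    refine ENNReal.toReal_le_of_le_ofReal hc0.le S.2.2
  have hopt := optRevenue_ge hc0 hc1 hK hcard hI
  have hd := revenue_le_optRevenue hc0 hc1 hK2 I S
  have hrev := revenue_perturbed hc0 hc1 hK2 I S.1
  obtain ⟨hV1, hV2⟩ := setIntegral_perturbed_bounds hc0 hc1 hK I S.1
  have hτ := setIntegral_sum_binBump_le (K := K) hc0 (by omega) I S.1
  have hβ := betaPar_nonneg (K := K) hc0
  set V := ∫ x in S.1, perturbed c K I x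
  set r := revenue (margin c) (perturbed c K I) S.1
  set o := optRevenue c (margin c) (perturbed c K I)
  set A := ∑ i ∈ I, volume.real (bin c K i ∩ S.1)
  set g := 19 / 50 * (c ^ 2 / K) / (1 + 201 / 100 * c) with hg
  have hV0 : 0 < 1 + V := by linarith
  have hcK : 0 ≤ c ^ 2 / K := by positivity
  have hcK1 : c ^ 2 / K ≤ 1 := by
    rw [div_le_one (by linarith)]
    nlinarith
  have hg0 : 0 ≤ g := by positivity
  have hg1 : g ≤ 1 := by
    rw [hg, div_le_one (by linarith)]
    linarith
  -- the gain is small unless `S` has full volume and overlaps the bins of `I`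
  have hgain : gain c K I S.1 ≤
      4 / 5 * (y - c) + 4 / 5 * (c ^ 2 / K) * (1 / 50 + 4 / 3 * (A / c)) := by
    have e : c ^ 2 / K * (1 / 50 + 4 / 3 * (A / c)) = c / K * (1 / 50 * c + 4 / 3 * A) := by
      field_simp
    have h1 : c / K * (1 / 50 * y + 4 / 3 * A) ≤ c / K * (1 / 50 * c + 4 / 3 * A) := by gcongr
    rw [gain, mul_assoc, e]
    nlinarith [mul_nonneg hβ hy0]
  have hgc : 199 / 250 * (19 / 50 * (c ^ 2 / K)) ≤ g * (1 + 79 / 100 * c) := by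
    rw [hg, div_mul_eq_mul_div (19 / 50 * (c ^ 2 / (K : ℝ))), le_div_iff₀ (by linarith)]
    have h : 199 / 250 * (1 + 201 / 100 * c) ≤ 1 + 79 / 100 * c := by linarith
    nlinarith [mul_le_mul_of_nonneg_left h (show 0 ≤ 19 / 50 * (c ^ 2 / K) by positivity)]
  have hr : r * (1 + V) = sPar c * (1 + V) + gain c K I S.1 := by
    rw [hrev]
    field_simp
  have hmain : g * (1 + V) - gain c K I S.1 ≤ (o - r) * (1 + V) := by
    nlinarith
  -- an assortment of volume `y < c` has a smaller `V`, but it loses more through the volume term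
  have hgV : g * (1 + 79 / 100 * c) - 4 / 5 * (c - y) ≤ g * (1 + V) := by
    have h1 : g * (1 + 79 / 100 * y) ≤ g * (1 + V) := by gcongr
    nlinarith
  -- `o - r ≥ 0` and `1 + V ≤ 2`, so the division by `1 + V` costs a factor of two at most
  have htwo : (o - r) * (1 + V) ≤ (o - r) * 2 :=
    mul_le_mul_of_nonneg_left (by linarith) (by linarith)
  nlinarith

/-- Moving one bump changes the law of a purchase by `O(K ^ (-3))` in chi-squared divergence. -/
lemma divergence_perturbed_le (hc0 : 0 < c) (hc1 : c ≤ 1 / 4) (hK : 2 ≤ K) {I J : Finset ℕ}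
    {i j : ℕ} (hIJ : ∀ x, ∑ l ∈ J, binBump c K l x - ∑ l ∈ I, binBump c K l x =
      binBump c K j x - binBump c K i x) (S : Set Product) :
    (1 + ∫ x in S, perturbed c K I x) *
      (∫ x in S, (perturbed c K J x - perturbed c K I x) ^ 2 / perturbed c K I x) ≤
      1 / (K : ℝ) ^ 3 * (1 + ∫ x in S, perturbed c K J x) ^ 2 := by
  have hK' : (2 : ℝ) ≤ K := by exact_mod_cast hK
  have hcK := capacity_div_le hc1 hK
  have hcK0 : 0 ≤ c / K := by positivity
  have cI := continuous_pref (continuous_perturbed (K := K) hc0 I)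
  have cJ := continuous_pref (continuous_perturbed (K := K) hc0 J)
  have hlow : ∀ x : Product, 79 / 100 ≤ perturbed c K I x := fun x =>
    (perturbed_bounds hc0 hc1 hK I x.2).1
  have hb := fun l => integrableOn_pref (continuous_pref (continuous_binBump (c := c) (K := K) l)) S
  have hpt : ∀ x : Product, (perturbed c K J x - perturbed c K I x) ^ 2 / perturbed c K I x ≤
      7 * (c / K) * (binBump c K i x + binBump c K j x) := by
    intro x
    have h0 := hlow x
    obtain ⟨h1, h2⟩ := baseline_mem hc0 hc1 x.2
    have hi0 := binBump_nonneg (K := K) hc0 i x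
    have hj0 := binBump_nonneg (K := K) hc0 j x
    have hi1 := binBump_le (K := K) hc0 i x
    have hj1 := binBump_le (K := K) hc0 j x
    have hdiff : perturbed c K J x - perturbed c K I x =
        baseline c x * (binBump c K j x - binBump c K i x) := by
      rw [← hIJ, perturbed, perturbed]
      ring
    rw [hdiff, div_le_iff₀ (by linarith), mul_pow]
    have hsq : (binBump c K j x - binBump c K i x) ^ 2 ≤
        4 / 3 * (c / K) * (binBump c K i x + binBump c K j x) := by
      nlinarith [mul_nonneg hi0 hj0]
    have hbase : baseline c x ^ 2 ≤ 4 := by nlinarith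
    have hP : 0 ≤ c / K * (binBump c K i x + binBump c K j x) := by positivity
    calc _ ≤ 4 * (4 / 3 * (c / K) * (binBump c K i x + binBump c K j x)) :=
          mul_le_mul hbase hsq (sq_nonneg _) (by norm_num)
      _ ≤ 7 * (c / K) * (binBump c K i x + binBump c K j x) * (79 / 100) := by nlinarith
      _ ≤ _ := mul_le_mul_of_nonneg_left h0 (by positivity)
  have hq : ∫ x in S, (perturbed c K J x - perturbed c K I x) ^ 2 / perturbed c K I x ≤
      7 * (c / K) ^ 3 := by
    have h := integral_mono (μ := volume.restrict S)
      (integrableOn_pref (((cJ.sub cI).pow 2).div cI fun x => by linarith [hlow x]) S)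
      (((hb i).add (hb j)).const_mul (7 * (c / K))) hpt
    refine h.trans ?_
    rw [integral_const_mul, integral_add' (hb i) (hb j)]
    have h1 := setIntegral_binBump_le (K := K) hc0 (by omega) i S
    have h2 := setIntegral_binBump_le (K := K) hc0 (by omega) j S
    calc _ ≤ 7 * (c / K) * (1 / 2 * (c / K) ^ 2 + 1 / 2 * (c / K) ^ 2) := by gcongr
      _ = _ := by ring
  have hV : ∫ x in S, perturbed c K I x ≤ 3 := by
    have h := integral_mono (μ := volume.restrict S) (integrableOn_pref cI S)
      (integrable_const (3 : ℝ)) fun x => by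
        have := (perturbed_bounds hc0 hc1 hK I x.2).2
        change perturbed c K I x ≤ 3
        linarith
    simp only [integral_const, measureReal_restrict_apply_univ, smul_eq_mul] at h
    have hS : volume.real S ≤ 1 := measureReal_le_one
    linarith
  have hVI := setIntegral_perturbed_nonneg hc0 hc1 hK I S
  have hVJ := setIntegral_perturbed_nonneg hc0 hc1 hK J S
  have hc3 : 28 * (c / K) ^ 3 ≤ 1 / (K : ℝ) ^ 3 := by
    rw [div_pow, mul_div_assoc']
    gcongr
    calc 28 * c ^ 3 ≤ 28 * (1 / 4) ^ 3 := by gcongr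
      _ ≤ 1 := by norm_num
  calc _ ≤ 4 * (7 * (c / K) ^ 3) := by
        refine mul_le_mul (by linarith) hq (integral_nonneg fun x => ?_) (by norm_num)
        exact div_nonneg (sq_nonneg _) (by linarith [hlow x])
    _ ≤ 1 / (K : ℝ) ^ 3 * 1 := by linarith
    _ ≤ _ := by
      gcongr
      exact one_le_pow₀ (by linarith)

/-! ### The prior on the bin sets and the lower bound -/

/-- One bin out of each of the `K` groups `{4 g + 1, …, 4 g + 4}`, `g < K`: the bin `f g` of the
group `g`. -/
def selectedBins (f : Fin K → Fin 4) : Finset ℕ :=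
  Finset.univ.image fun g : Fin K => 4 * (g : ℕ) + f g + 1

lemma selectedBins_injective (f : Fin K → Fin 4) :
    Function.Injective fun g : Fin K => 4 * (g : ℕ) + f g + 1 := fun g g' h => by
  simp only at h
  have := (f g).2
  have := (f g').2
  ext
  omega

lemma sum_selectedBins (f : Fin K → Fin 4) (F : ℕ → ℝ) :
    ∑ i ∈ selectedBins f, F i = ∑ g : Fin K, F (4 * (g : ℕ) + f g + 1) :=
  Finset.sum_image (selectedBins_injective f).injOn

lemma card_selectedBins (f : Fin K → Fin 4) : (selectedBins f).card = K := by
  rw [selectedBins, Finset.card_image_of_injective _ (selectedBins_injective f)]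
  simp

lemma groupIndex_bounds (hc1 : c ≤ 1 / 4) (g : Fin K) (a : Fin 4) :
    1 ≤ 4 * (g : ℕ) + a + 1 ∧ c * ((4 * (g : ℕ) + a + 1 : ℕ) : ℝ) ≤ K := by
  refine ⟨by omega, ?_⟩
  have h : 4 * (g : ℕ) + a + 1 ≤ 4 * K := by omega
  have h' : ((4 * (g : ℕ) + a + 1 : ℕ) : ℝ) ≤ 4 * K := by exact_mod_cast h
  have : (0 : ℝ) ≤ K := Nat.cast_nonneg K
  nlinarith

lemma selectedBins_bounds (hc1 : c ≤ 1 / 4) (f : Fin K → Fin 4) :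
    ∀ i ∈ selectedBins f, 1 ≤ i ∧ c * (i : ℝ) ≤ K := by
  intro i hi
  obtain ⟨g, -, rfl⟩ := Finset.mem_image.1 hi
  exact groupIndex_bounds hc1 g (f g)

lemma selectedBins_mem_binSets (hc0 : 0 < c) (hc1 : c ≤ 1 / 4) (f : Fin K → Fin 4) :
    selectedBins f ∈ binSets c K := by
  refine Finset.mem_powersetCard.2 ⟨fun i hi => ?_, card_selectedBins f⟩
  obtain ⟨h1, h2⟩ := selectedBins_bounds hc1 f i hi
  refine Finset.mem_Icc.2 ⟨h1, Nat.le_floor ?_⟩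
  rw [le_div_iff₀ hc0]
  linarith

lemma sum_selectedBins_update_sub (f : Fin K → Fin 4) (g : Fin K) (a : Fin 4) (F : ℕ → ℝ) :
    ∑ i ∈ selectedBins (Function.update f g a), F i - ∑ i ∈ selectedBins f, F i =
      F (4 * (g : ℕ) + a + 1) - F (4 * (g : ℕ) + f g + 1) := by
  rw [sum_selectedBins, sum_selectedBins, ← Finset.sum_sub_distrib,
    Finset.sum_eq_single g _ (by simp)]
  · simp
  · intro g' _ hg'
    simp [hg']

/-- When `K ^ 3` dominates the number of periods, resampling one coordinate of `f` leaves the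
joint laws of the outcomes close in chi-squared divergence. -/
lemma outcomeLaw_likelihood (hc0 : 0 < c) (hc1 : c ≤ 1 / 4) (hK : 2 ≤ K) (f : Fin K → Fin 4)
    (g : Fin K) (a : Fin 4) (π : Policy c) (t : ℕ) (ht : 1000000 * (t : ℝ) ≤ (K : ℝ) ^ 3)
    {F : (Fin t → Outcome) → ENNReal} (hF : Measurable F) :
    (∫⁻ h, F h ∂outcomeLaw (perturbed c K (selectedBins (Function.update f g a))) π t) ^ 2 ≤
      ENNReal.ofReal (1 + (1 / 100) ^ 2) *
        ∫⁻ h, F h ^ 2 ∂outcomeLaw (perturbed c K (selectedBins f)) π t := by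
  have hK' : (0 : ℝ) < (K : ℝ) ^ 3 := by positivity
  have hpos : ∀ I : Finset ℕ, ∀ x ∈ Set.Icc (0 : ℝ) 1, 0 < perturbed c K I x := fun I x hx => by
    have := (perturbed_bounds hc0 hc1 hK I hx).1
    linarith
  have h := sq_lintegral_outcomeLaw_le (continuous_perturbed hc0 (selectedBins f))
    (continuous_perturbed hc0 (selectedBins (Function.update f g a)))
    (fun x hx => (hpos _ x hx).le) (fun x hx => (hpos _ x hx).le)
    (R := ENNReal.ofReal (1 + 1 / (K : ℝ) ^ 3))
    (fun S F hF => sq_lintegral_purchaseLaw_le (continuous_perturbed hc0 _)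
      (continuous_perturbed hc0 _) (hpos _) (fun x hx => (hpos _ x hx).le) S (by positivity)
      (divergence_perturbed_le hc0 hc1 hK
        (fun x => sum_selectedBins_update_sub f g a fun i => binBump c K i x) S) hF) π t hF
  refine h.trans ?_
  gcongr
  rw [← ENNReal.ofReal_pow (by positivity)]
  refine ENNReal.ofReal_le_ofReal ?_
  have hexp : (1 + 1 / (K : ℝ) ^ 3) ^ t ≤ Real.exp (1 / 1000000) := by
    calc (1 + 1 / (K : ℝ) ^ 3) ^ t ≤ Real.exp (1 / (K : ℝ) ^ 3) ^ t := by
          gcongr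
          linarith [Real.add_one_le_exp (1 / (K : ℝ) ^ 3)]
      _ = Real.exp (t * (1 / (K : ℝ) ^ 3)) := (Real.exp_nat_mul _ _).symm
      _ ≤ _ := by
        refine Real.exp_le_exp.2 ?_
        rw [mul_one_div, div_le_iff₀ hK']
        linarith
  refine hexp.trans ((Real.exp_bound_div_one_sub_of_interval (by norm_num) (by norm_num)).trans ?_)
  norm_num

/-- The expected fraction of the bin `a` of the group `g` that is offered in period `t + 1`. -/
noncomputable def coverage (π : Policy c) (t : ℕ) (f : Fin K → Fin 4) (g : Fin K) (a : Fin 4) :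
    ℝ :=
  ∫ h, volume.real (bin c K (4 * (g : ℕ) + a + 1) ∩ (offered π.act t h).1) / (c / K)
    ∂outcomeLaw (perturbed c K (selectedBins f)) π t

lemma measurable_volume_inter_offered (π : Policy c) (t i : ℕ) :
    Measurable fun h => volume.real (bin c K i ∩ (offered π.act t h).1) :=
  (π.measurable_offered t _ (measurableSet_bin i)).ennreal_toReal

lemma isProbabilityMeasure_outcomeLaw_perturbed (hc0 : 0 < c) (hc1 : c ≤ 1 / 4) (hK : 2 ≤ K)
    (I : Finset ℕ) (π : Policy c) (t : ℕ) :
    IsProbabilityMeasure (outcomeLaw (perturbed c K I) π t) :=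
  isProbabilityMeasure_outcomeLaw (continuous_perturbed hc0 I) (fun x hx => by
    have := (perturbed_bounds hc0 hc1 hK I hx).1
    linarith) π t

lemma integrable_volume_inter_offered (P : (t : ℕ) → Measure (Fin t → Outcome)) (π : Policy c)
    (t i : ℕ) [IsFiniteMeasure (P t)] :
    Integrable (fun h => volume.real (bin c K i ∩ (offered π.act t h).1)) (P t) :=
  Integrable.of_bound (measurable_volume_inter_offered π t i).aestronglyMeasurable 1
    (Filter.Eventually.of_forall fun h => by
      rw [Real.norm_eq_abs, abs_of_nonneg measureReal_nonneg]
      exact measureReal_le_one)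

/-- Resampling the selected bin of a group hardly changes how much the policy covers a bin. -/
lemma coverage_update_le (hc0 : 0 < c) (hc1 : c ≤ 1 / 4) (hK : 2 ≤ K) (π : Policy c) (t : ℕ)
    (ht : 1000000 * (t : ℝ) ≤ (K : ℝ) ^ 3) (f : Fin K → Fin 4) (g : Fin K) (a : Fin 4) :
    coverage π t (Function.update f g a) g a ≤ coverage π t f g a + 1 / 100 := by
  have hK' : (0 : ℝ) < K := by positivity
  have := isProbabilityMeasure_outcomeLaw_perturbed hc0 hc1 hK (selectedBins f) π t
  have := isProbabilityMeasure_outcomeLaw_perturbed hc0 hc1 hK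
    (selectedBins (Function.update f g a)) π t
  refine integral_le_add_of_sq_lintegral_le (by norm_num) (by norm_num)
    (fun F hF => outcomeLaw_likelihood hc0 hc1 hK f g a π t ht hF)
    ((measurable_volume_inter_offered π t _).div_const _) fun h => ⟨?_, ?_⟩
  · exact div_nonneg measureReal_nonneg (by positivity)
  · rw [div_le_one (by positivity), ← volume_bin hc0 (groupIndex_bounds hc1 g a).1
      (groupIndex_bounds hc1 g a).2]
    exact measureReal_mono Set.inter_subset_left

lemma sum_coverage_le (hc0 : 0 < c) (hc1 : c ≤ 1 / 4) (hK : 2 ≤ K) (π : Policy c) (t : ℕ)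
    (f : Fin K → Fin 4) : ∑ g, ∑ a, coverage π t f g a ≤ K := by
  have hK' : (0 : ℝ) < K := by positivity
  have := isProbabilityMeasure_outcomeLaw_perturbed hc0 hc1 hK (selectedBins f) π t
  have hint := fun i => (integrable_volume_inter_offered (K := K)
    (outcomeLaw (perturbed c K (selectedBins f)) π) π t i).div_const (c / K)
  simp_rw [coverage]
  simp_rw [← integral_finsetSum _ fun (a : Fin 4) _ => hint (4 * (_ : Fin K).1 + a + 1)]
  rw [← integral_finsetSum _ fun g _ => integrable_finsetSum _ fun a _ => hint _]
  have hpt : ∀ h : Fin t → Outcome, ∑ g : Fin K, ∑ a : Fin 4,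
      volume.real (bin c K (4 * (g : ℕ) + a + 1) ∩ (offered π.act t h).1) / (c / K) ≤ K := by
    intro h
    have hinj : Function.Injective fun p : Fin K × Fin 4 => 4 * (p.1 : ℕ) + p.2 + 1 := by
      rintro ⟨g, a⟩ ⟨g', a'⟩ h
      simp only at h
      ext <;> simp only <;> omega
    have h1 := sum_volume_inter_bin_le hc0 (by omega : 0 < K)
      (Finset.univ.image fun p : Fin K × Fin 4 => 4 * (p.1 : ℕ) + p.2 + 1) (offered π.act t h).1
    rw [Finset.sum_image hinj.injOn, Fintype.sum_prod_type] at h1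
    simp_rw [← Finset.sum_div]
    rw [div_le_iff₀ (by positivity), mul_div_cancel₀ _ hK'.ne']
    exact h1.trans (ENNReal.toReal_le_of_le_ofReal hc0.le (offered π.act t h).2.2)
  refine (integral_mono (integrable_finsetSum _ fun g _ => integrable_finsetSum _ fun a _ =>
    hint _) (integrable_const (K : ℝ)) hpt).trans_eq ?_
  simp

/-- Averaging over a uniform choice `f`: if a functional of coordinate `g` hardly notices that
`f g` is resampled, then it cannot single out the value `f g` among the four candidates. -/
lemma sum_selected_le {E : (Fin K → Fin 4) → Fin K → Fin 4 → ℝ} {l : ℝ}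
    (hE : ∀ f, ∑ g, ∑ a, E f g a ≤ K)
    (hl : ∀ f g a, E (Function.update f g a) g a ≤ E f g a + l) :
    ∑ f, ∑ g, E f g (f g) ≤ (4 : ℝ) ^ K * (K / 4 + K * l) := by
  have hcard : (Fintype.card (Fin K → Fin 4) : ℝ) = 4 ^ K := by simp
  -- `(f, a) ↦ (update f g a, f g)` is an involution
  have hswap : ∀ g, 4 * ∑ f, E f g (f g) = ∑ f, ∑ a, E (Function.update f g a) g a := by
    intro g
    have hinv : Function.Involutive fun p : (Fin K → Fin 4) × Fin 4 =>
        (Function.update p.1 g p.2, p.1 g) := fun p => by simp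
    have h := Equiv.sum_comp hinv.toPerm fun p : (Fin K → Fin 4) × Fin 4 => E p.1 g (p.1 g)
    rw [Fintype.sum_prod_type, Fintype.sum_prod_type] at h
    simp only [Function.Involutive.coe_toPerm, Function.update_self, Finset.sum_const,
      Finset.card_univ, Fintype.card_fin, nsmul_eq_mul] at h
    rw [h, ← Finset.mul_sum]
    norm_num
  have h4 : 4 * ∑ f, ∑ g, E f g (f g) ≤ (4 : ℝ) ^ K * (K + 4 * K * l) := by
    rw [Finset.sum_comm, Finset.mul_sum]
    simp_rw [hswap]
    rw [Finset.sum_comm]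
    calc ∑ f, ∑ g, ∑ a, E (Function.update f g a) g a
        ≤ ∑ f, ∑ g, ∑ a, (E f g a + l) :=
          Finset.sum_le_sum fun f _ => Finset.sum_le_sum fun g _ => Finset.sum_le_sum fun a _ =>
            hl f g a
      _ = ∑ f, ((∑ g, ∑ a, E f g a) + 4 * K * l) := by
          refine Finset.sum_congr rfl fun f _ => ?_
          simp_rw [Finset.sum_add_distrib]
          simp
          ring
      _ ≤ ∑ _f : Fin K → Fin 4, ((K : ℝ) + 4 * K * l) :=
          Finset.sum_le_sum fun f _ => by linarith [hE f]
      _ = _ := by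
          rw [Finset.sum_const, Finset.card_univ, nsmul_eq_mul, hcard]
  linarith

/-- The regret is governed by the coverage of the selected bins. -/
lemma regret_ge (hc0 : 0 < c) (hc1 : c ≤ 1 / 4) (hK : 100 ≤ K) (π : Policy c) (T : ℕ)
    (f : Fin K → Fin 4) :
    ∑ t ∈ Finset.range T, 2 / 5 * (c ^ 2 / K) *
      (179 / 500 - 4 / 3 * ((∑ g, coverage π t f g (f g)) / K)) ≤
      regret (margin c) π T (perturbed c K (selectedBins f)) := by
  have hK2 : 2 ≤ K := by omega
  have hK' : (0 : ℝ) < K := by positivity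
  refine Finset.sum_le_sum fun t _ => ?_
  have hprob := isProbabilityMeasure_outcomeLaw_perturbed hc0 hc1 hK2 (selectedBins f) π t
  set P := outcomeLaw (perturbed c K (selectedBins f)) π t
  have hint := fun i => integrable_volume_inter_offered (K := K)
    (outcomeLaw (perturbed c K (selectedBins f)) π) π t i
  have hrev : Measurable fun h : Fin t → Outcome =>
      revenue (margin c) (perturbed c K (selectedBins f)) (offered π.act t h).1 := by
    have cv := continuous_pref (continuous_perturbed (K := K) hc0 (selectedBins f))
    exact (measurable_integral_offered π t (cv.mul continuous_margin)).div
      ((measurable_integral_offered π t cv).const_add 1)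
  have irev : Integrable (fun h : Fin t → Outcome =>
      optRevenue c (margin c) (perturbed c K (selectedBins f)) -
      revenue (margin c) (perturbed c K (selectedBins f)) (offered π.act t h).1) P := by
    refine (integrable_const _).sub (Integrable.of_bound hrev.aestronglyMeasurable 1
      (Filter.Eventually.of_forall fun h => ?_))
    rw [Real.norm_eq_abs, abs_of_nonneg (revenue_nonneg hc0 hc1 hK2 _ _)]
    exact revenue_le_one hc0 hc1 hK2 _ _
  have isum : Integrable (fun h : Fin t → Outcome =>
      ∑ i ∈ selectedBins f, volume.real (bin c K i ∩ (offered π.act t h).1)) P :=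
    integrable_finsetSum _ fun i _ => hint i
  have ilow : Integrable (fun h : Fin t → Outcome => 2 / 5 * (c ^ 2 / K) * (179 / 500 - 4 / 3 *
      ((∑ i ∈ selectedBins f, volume.real (bin c K i ∩ (offered π.act t h).1)) / c))) P :=
    ((integrable_const (179 / 500 : ℝ)).sub ((isum.div_const c).const_mul (4 / 3))).const_mul _
  refine le_trans (le_of_eq ?_) (integral_mono ilow irev fun h =>
    optRevenue_sub_revenue_ge hc0 hc1 hK (card_selectedBins f) (selectedBins_bounds hc1 f)
      (offered π.act t h))
  rw [integral_const_mul, integral_sub (integrable_const _) ((isum.div_const c).const_mul _),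
    integral_const_mul, integral_div c, integral_finsetSum _ fun i _ => hint i,
    sum_selectedBins f fun i => ∫ h, volume.real (bin c K i ∩ (offered π.act t h).1) ∂P]
  simp only [integral_const, probReal_univ, one_smul, coverage, integral_div]
  rw [← Finset.sum_div]
  congr 3
  field_simp
  rfl

/-- On average over `f`, a policy covers at most the fraction `1 / 4 + 1 / 100 = 13 / 50` of the
selected bins, and `179 / 500 - 4 / 3 * 13 / 50 > 1 / 100`. -/
lemma exists_regret_ge (hc0 : 0 < c) (hc1 : c ≤ 1 / 4) (hK : 100 ≤ K) (π : Policy c) (T : ℕ)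
    (hT : 1000000 * (T : ℝ) ≤ (K : ℝ) ^ 3) :
    ∃ f : Fin K → Fin 4, T * (c ^ 2 / (250 * K)) ≤
      regret (margin c) π T (perturbed c K (selectedBins f)) := by
  have hK2 : 2 ≤ K := by omega
  have hK' : (0 : ℝ) < K := by positivity
  have hcard : (Fintype.card (Fin K → Fin 4) : ℝ) = 4 ^ K := by simp
  obtain ⟨f, -, hf⟩ := Finset.exists_le_of_sum_le (s := (Finset.univ : Finset (Fin K → Fin 4)))
    (f := fun _ => T * (c ^ 2 / (250 * K)))
    (g := fun f => regret (margin c) π T (perturbed c K (selectedBins f)))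
    Finset.univ_nonempty (by
      refine le_trans ?_ (Finset.sum_le_sum fun f _ => regret_ge hc0 hc1 hK π T f)
      rw [Finset.sum_comm]
      calc ∑ _f : Fin K → Fin 4, T * (c ^ 2 / (250 * K))
          = ∑ _t ∈ Finset.range T, 4 ^ K * (c ^ 2 / (250 * K)) := by
            rw [Finset.sum_const, Finset.sum_const, Finset.card_univ, Finset.card_range,
              nsmul_eq_mul, nsmul_eq_mul, hcard]
            ring
        _ ≤ _ := Finset.sum_le_sum fun t ht => ?_
      have htT : (t : ℝ) ≤ T := by exact_mod_cast (Finset.mem_range.1 ht).le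
      have h := sum_selected_le (E := coverage π t) (l := 1 / 100)
        (sum_coverage_le hc0 hc1 hK2 π t)
        (coverage_update_le hc0 hc1 hK2 π t (by linarith))
      rw [← Finset.mul_sum, Finset.sum_sub_distrib, ← Finset.mul_sum, Finset.sum_const, Finset.card_univ, nsmul_eq_mul, hcard]
      have h' : ∑ f : Fin K → Fin 4, (∑ g, coverage π t f g (f g)) / K ≤
          (4 : ℝ) ^ K * (13 / 50) := by
        rw [← Finset.sum_div, div_le_iff₀ hK']
        linarith
      calc (4 : ℝ) ^ K * (c ^ 2 / (250 * K)) = 2 / 5 * (c ^ 2 / K) * (4 ^ K * (1 / 100)) := by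
            field_simp
            norm_num
        _ ≤ _ := by
          gcongr
          have : (0 : ℝ) < 4 ^ K := by positivity
          linarith)
  exact ⟨f, hf⟩

end ContAssortment

theorem theorem4 (c : ℝ) (hc0 : 0 < c) (hc1 : c ≤ 1 / 4) :
    (∀ vlo vhi : ℝ, 0 < vlo → vlo < 79 / 100 → 4 ≤ vhi →
      ContAssortment.RegularClass (ContAssortment.margin c) vlo vhi
        (ContAssortment.hardFamily c)) ∧
    ∃ C : ℝ, 0 < C ∧
      ∀ vlo vhi : ℝ, 0 < vlo → vlo < 79 / 100 → 4 ≤ vhi →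
      ∀ V : Set (ℝ → ℝ),
        ContAssortment.RegularClass (ContAssortment.margin c) vlo vhi V →
        ContAssortment.hardFamily c ⊆ V →
      ∀ (T : ℕ) (π : ContAssortment.Policy c),
        ((C * (T : ℝ) ^ ((2 : ℝ) / 3) : ℝ) : EReal) ≤
          ContAssortment.worstCaseRegret (ContAssortment.margin c) V π T := by
  refine ⟨fun vlo vhi h0 h1 h2 => ContAssortment.regularClass_hardFamily hc0 hc1 h0 h1 h2,
    c ^ 2 / 100000, by positivity, ?_⟩
  intro vlo vhi _ _ _ V _ hV T π
  -- the number of bins is of the order `T ^ (1 / 3)`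
  set x : ℝ := (T : ℝ) ^ ((1 : ℝ) / 3) with hx
  have hT0 : (0 : ℝ) ≤ T := Nat.cast_nonneg T
  have hx0 : 0 ≤ x := Real.rpow_nonneg hT0 _
  have hx3 : x ^ 3 = T := by
    rw [hx, ← Real.rpow_natCast, ← Real.rpow_mul hT0]
    norm_num
  have hx2 : (T : ℝ) ^ ((2 : ℝ) / 3) = x ^ 2 := by
    rw [hx, ← Real.rpow_natCast, ← Real.rpow_mul hT0]
    norm_num
  set K : ℕ := ⌈100 * x⌉₊ + 100 with hK
  have hKlow : 100 * x ≤ K := by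
    rw [hK]
    push_cast
    linarith [Nat.le_ceil (100 * x)]
  have hKhigh : (K : ℝ) ≤ 100 * x + 101 := by
    rw [hK]
    push_cast
    linarith [(Nat.ceil_lt_add_one (by positivity : 0 ≤ 100 * x)).le]
  have hTK : 1000000 * (T : ℝ) ≤ (K : ℝ) ^ 3 := by
    rw [← hx3]
    calc 1000000 * x ^ 3 = (100 * x) ^ 3 := by ring
      _ ≤ _ := by gcongr
  obtain ⟨f, hf⟩ := ContAssortment.exists_regret_ge hc0 hc1 (by omega : 100 ≤ K) π T hTK
  have hmem : ContAssortment.perturbed c K (ContAssortment.selectedBins f) ∈ V :=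
    hV ⟨K, by omega, _, ContAssortment.selectedBins_mem_binSets hc0 hc1 f, rfl⟩
  refine le_trans (EReal.coe_le_coe_iff.2 (le_trans ?_ hf)) (le_iSup₂_of_le _ hmem le_rfl)
  have hKpos : (0 : ℝ) < K := by positivity
  rw [hx2, ← hx3, mul_div_assoc', le_div_iff₀ (by positivity)]
  have hx01 : x ^ 2 ≤ x ^ 3 := by
    rcases Nat.eq_zero_or_pos T with h | h
    · have : x = 0 := by simpa [h] using hx3
      simp [this]
    · have : 1 ≤ x := Real.one_le_rpow (by exact_mod_cast h) (by norm_num)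
      exact pow_le_pow_right₀ this (by norm_num)
  have h1 : x ^ 2 * K ≤ 201 * x ^ 3 := by
    nlinarith [mul_le_mul_of_nonneg_left hKhigh (sq_nonneg x)]
  have hc2 : 0 < c ^ 2 := by positivity
  nlinarith [mul_le_mul_of_nonneg_left h1 hc2.le, mul_nonneg hc2.le (pow_nonneg hx0 3)]
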